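/- Let $\Phi$ be a finite irreducible crystallographic (reduced) root system of rank $n$, spanning a real vector space $V$. A set $B\subseteq\Phi$ is closed if $a\alpha+b\beta\in B$ whenever $\alpha,\beta\in B$, $a,b\in\mathbb{R}_{>0}$ and $a\alpha+b\beta\in\Phi$; it is biclosed if both $B$ and $\Phi\setminus B$ are closed. An admissible chain is a chain $\emptyset=B_0\subsetneq B_1\subsetneq\cdots\subsetneq B_k=\Phi$ of biclosed sets such that for each $0\le i<k$ either $B_{i+1}\setminus B_i\subseteq -B_i$, and we put $\epsilon_i=1$, or $(B_{i+1}\setminus B_i)\cap(-B_{i+1})=\emptyset$, and we put $\epsilon_i=0$. (These two cases exclude each other.) The word $\epsilon_0\epsilon_1\cdots\epsilon_{k-1}$ is the signature of the chain. An admissible chain is maximal if no other admissible chain contains all of its members. An extended Dyck word of length $2n$ is a word with $n$ letters $0$ and $n$ letters $1$ such that every nonempty initial segment of length less than $2n$ contains strictly fewer letters $1$ than letters $0$. A $2n$-trimmed Dyck word is a word obtained from an extended Dyck word of length $2n$ by replacing some (possibly none) pairwise disjoint nonempty blocks of consecutive equal letters $\epsilon\epsilon\cdots\epsilon$ by the single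 letter $\epsilon$. Then: 1. The set of signatures of the maximal admissible chains of biclosed sets in $\Phi$ is precisely the set of extended Dyck words of length $2n$. 2. The set of signatures of all admissible chains of biclosed sets in $\Phi$ is precisely the set of $2n$-trimmed Dyck words. -/

import Mathlib

open scoped Pointwise

section Biclosed

variable {V : Type*} [AddCommGroup V] [Module ℝ V]

/-- `B` is closed in the set of roots `Φ`: it contains every root that is a positive real
combination of two of its elements. -/
def IsClosedIn (Φ B : Set V) : Prop :=
  ∀ α ∈ B, ∀ β ∈ B, ∀ a b : ℝ, 0 < a → 0 < b → a • α + b • β ∈ Φ → a • α + b • β ∈ B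

/-- `B` is biclosed in `Φ`: it is a subset of `Φ`, and both it and its complement in `Φ` are
closed. -/
def IsBiclosedIn (Φ B : Set V) : Prop :=
  B ⊆ Φ ∧ IsClosedIn Φ B ∧ IsClosedIn Φ (Φ \ B)

/-- The pair `Γ₁ ⊂ Γ₂` is admissible: either the negative of every new element is already
in `Γ₁` (the step is labelled `1`), or the negative of no new element is in `Γ₂` (the step is
labelled `0`). -/
def IsAdmissiblePair (Γ₁ Γ₂ : Set V) : Prop :=
  Γ₂ \ Γ₁ ⊆ -Γ₁ ∨ (Γ₂ \ Γ₁) ∩ -Γ₂ = ∅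

/-- `∅ = B 0 ⊂ B 1 ⊂ ⋯ ⊂ B k = Φ` is an admissible chain of biclosed sets in `Φ`. -/
structure IsAdmissibleChain (Φ : Set V) {k : ℕ} (B : Fin (k + 1) → Set V) : Prop where
  zero : B 0 = ∅
  last : B (Fin.last k) = Φ
  strictMono : StrictMono B
  biclosed : ∀ i, IsBiclosedIn Φ (B i)
  admissible : ∀ i : Fin k, IsAdmissiblePair (B i.castSucc) (B i.succ)

/-- An admissible chain is maximal if no admissible chain properly refines it. -/
def IsMaximalAdmissibleChain (Φ : Set V) {k : ℕ} (B : Fin (k + 1) → Set V) : Prop :=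
  IsAdmissibleChain Φ B ∧
    ∀ (m : ℕ) (C : Fin (m + 1) → Set V), IsAdmissibleChain Φ C →
      Set.range B ⊆ Set.range C → Set.range C = Set.range B

open Classical in
/-- The signature of a chain: its `i`-th letter is `1` if `B (i + 1) \ B i ⊆ -B i`. In an
admissible chain the other case is the one in which `B (i + 1) \ B i` is disjoint
from `-B (i + 1)`, equivalently (the two cases being exclusive) from `-B i`. -/
noncomputable def signature {k : ℕ} (B : Fin (k + 1) → Set V) : List (Fin 2) :=
  List.ofFn fun i : Fin k =>
    if B i.succ \ B i.castSucc ⊆ -(B i.castSucc) then (1 : Fin 2) else 0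

end Biclosed

/-- An extended Dyck word of length `2n`: `n` letters `0` and `n` letters `1`, and every
nonempty proper initial segment has strictly fewer letters `1` than letters `0`. -/
def IsExtendedDyckWord (n : ℕ) (w : List (Fin 2)) : Prop :=
  w.count 0 = n ∧ w.count 1 = n ∧
    ∀ i, 0 < i → i < 2 * n → (w.take i).count 1 < (w.take i).count 0

/-- A `2n`-trimmed Dyck word: some extended Dyck word of length `2n` is cut into nonempty
constant blocks, and each block is replaced by a single copy of its letter. (A block of
length `1` is left as it is.) A block `ε ⋯ ε` of length `m` is recorded as the pair `(ε, m)`. -/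
def IsTrimmedDyckWord (n : ℕ) (v : List (Fin 2)) : Prop :=
  ∃ blocks : List (Fin 2 × ℕ), (∀ b ∈ blocks, 0 < b.2) ∧
    IsExtendedDyckWord n (blocks.flatMap fun b => List.replicate b.2 b.1) ∧
    v = blocks.map Prod.fst

/-! Write `n` for the rank and attach two numbers to a biclosed set `B`: the dimension `r₁` of the
span of its two-sided part, and `r₀`, which is `n` minus the dimension of the span of the two-sided
part of its complement (`letterRank`). A step labelled `ε` strictly raises `r_ε` and fixes the other
number. Both run from `0` to `n` along a chain, so each letter occurs at most `n` times.

The two two-sided parts are orthogonal, so `r₁ ≤ r₀`. Equality would make a functional cutting out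
`B` vanish, splitting the roots into two orthogonal pieces; irreducibility therefore gives `r₁ < r₀`
unless `B` is empty or everything (`letterRank_one_lt`). For words of length `2n` this is the Dyck
condition. A step raising its rank by at least two can be refined by tilting the functional
(`IsBiclosedIn.exists_between`), with the same label on both halves. So the maximal chains are those
of length `2n`, and every chain refines to one of them. Conversely, consecutive steps with equal
labels may always be merged (`StepRel.trans`), which accounts for the trimmed words.

To realise a given word, fix a base and let sets `A`, `R` of simple roots grow, a letter `1`
enlarging `A` and a letter `0` enlarging `R`. A partial height defines a biclosed set with two-sided
part supported on `A` and two-sided part of the complement supported off `R`, provided that `A` is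
orthogonal to the simple roots outside `R` (`Separated.isBiclosedIn`). Positive definiteness makes
the Dynkin graph a caterpillar, and sweeping along its spine
(`SimpleGraph.IsSubcritical.exists_sweep`) orders the growth so that this holds whenever `R` is
ahead of `A`, as in every extended Dyck word. -/

section BiclosedTheory

/-! ### Labelled steps and two-sided parts -/

variable {V : Type*} [AddCommGroup V]

/-- The part of `B` which is stable under negation. -/
def symmPart (B : Set V) : Set V := B ∩ -B

lemma mem_symmPart {B : Set V} {x : V} : x ∈ symmPart B ↔ x ∈ B ∧ -x ∈ B := Iff.rfl

lemma neg_mem_symmPart {B : Set V} {x : V} (h : x ∈ symmPart B) : -x ∈ symmPart B :=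
  ⟨h.2, by simpa using h.1⟩

/-- The relation between consecutive members of an admissible chain whose step is labelled `ε`. -/
def StepRel (ε : Fin 2) (A B : Set V) : Prop :=
  if ε = 1 then B \ A ⊆ -A else (B \ A) ∩ -B = ∅

lemma stepRel_one {A B : Set V} : StepRel 1 A B ↔ ∀ x ∈ B, x ∉ A → -x ∈ A := by
  simp [StepRel, Set.subset_def]

lemma stepRel_zero {A B : Set V} : StepRel 0 A B ↔ ∀ x ∈ B, x ∉ A → -x ∉ B := by
  simp [StepRel, Set.ext_iff]

/-- For label `1`, an element new in the second step has its negative in `B`; if that negative were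
new in the first step, the element itself would lie in `A`. Label `0` is similar. This is what
allows a block of equal letters to be trimmed. -/
lemma StepRel.trans {ε : Fin 2} {A B C : Set V}
    (h₁ : StepRel ε A B) (h₂ : StepRel ε B C) : StepRel ε A C := by
  fin_cases ε
  · simp only [Fin.zero_eta, stepRel_zero] at *
    intro x hx hxA hn
    by_cases hxB : x ∈ B
    · by_cases hnB : -x ∈ B
      · exact h₁ x hxB hxA hnB
      · exact h₂ (-x) hn hnB (by simpa using hx)
    · exact h₂ x hx hxB hn
  · simp only [Fin.mk_one, stepRel_one] at *
    intro x hx hxA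
    by_cases hxB : x ∈ B
    · exact h₁ x hxB hxA
    · by_contra hn
      exact hxA (by simpa using h₁ (-x) (h₂ x hx hxB) hn)

lemma StepRel.mono {ε : Fin 2} {A B C D : Set V} (h : StepRel ε A D) (hAB : A ⊆ B)
    (hCD : C ⊆ D) : StepRel ε B C := by
  fin_cases ε
  · simp only [Fin.zero_eta, stepRel_zero] at *
    exact fun x hx hxB hn ↦ h x (hCD hx) (fun hA ↦ hxB (hAB hA)) (hCD hn)
  · simp only [Fin.mk_one, stepRel_one] at *
    exact fun x hx hxB ↦ hAB (h x (hCD hx) fun hA ↦ hxB (hAB hA))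

lemma StepRel.not_one {A B : Set V} (hAB : A ⊂ B) (h : StepRel 0 A B) : ¬ StepRel 1 A B := by
  rw [stepRel_zero] at h
  rw [stepRel_one]
  intro h'
  obtain ⟨x, hx, hxA⟩ := Set.exists_of_ssubset hAB
  exact h x hx hxA (hAB.1 (h' x hx hxA))

lemma isAdmissiblePair_iff {A B : Set V} :
    IsAdmissiblePair A B ↔ StepRel 1 A B ∨ StepRel 0 A B := by
  simp [IsAdmissiblePair, StepRel]

/-- Complementation reverses chains and exchanges the two labels, so statements about one label
transfer to the other. -/
lemma StepRel.zero_diff {Φ A B : Set V} (h : StepRel 1 A B) :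
    StepRel 0 (Φ \ B) (Φ \ A) := by
  rw [stepRel_zero]
  rw [stepRel_one] at h
  intro x hx hxB hn
  have : x ∈ B := by by_contra hB; exact hxB ⟨hx.1, hB⟩
  exact hn.2 (h x this hx.2)

lemma StepRel.one_diff {Φ A B : Set V} (hΦ : ∀ x ∈ Φ, -x ∈ Φ) (h : StepRel 0 A B) :
    StepRel 1 (Φ \ B) (Φ \ A) := by
  rw [stepRel_zero] at h
  rw [stepRel_one]
  intro x hx hxB
  have : x ∈ B := by by_contra hB; exact hxB ⟨hx.1, hB⟩
  exact ⟨hΦ x hx.1, h x this hx.2⟩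

lemma StepRel.symmPart_eq {A B : Set V} (hAB : A ⊆ B) (h : StepRel 0 A B) :
    symmPart B = symmPart A := by
  rw [stepRel_zero] at h
  refine Set.Subset.antisymm (fun x hx ↦ ?_) fun x hx ↦ ⟨hAB hx.1, hAB hx.2⟩
  rw [mem_symmPart] at hx ⊢
  constructor
  · by_contra hA
    exact h x hx.1 hA hx.2
  · by_contra hA
    exact h (-x) hx.2 hA (by simpa using hx.1)

lemma StepRel.symmPart_ssubset {A B : Set V} (hAB : A ⊂ B) (h : StepRel 1 A B) :
    symmPart A ⊂ symmPart B := by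
  rw [stepRel_one] at h
  obtain ⟨x, hx, hxA⟩ := Set.exists_of_ssubset hAB
  exact ⟨fun y hy ↦ ⟨hAB.1 hy.1, hAB.1 hy.2⟩,
    fun hle ↦ hxA (hle (a := x) ⟨hx, hAB.1 (h x hx hxA)⟩).1⟩

variable [Module ℝ V]

lemma IsClosedIn.add_smul_mem {Φ B : Set V} (h : IsClosedIn Φ B) {x y : V} (hx : x ∈ B)
    (hy : y ∈ B) {c : ℝ} (hc : 0 < c) (hm : x + c • y ∈ Φ) : x + c • y ∈ B := by
  simpa using h x hx y hy 1 c one_pos hc (by simpa using hm)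

lemma IsBiclosedIn.diff {Φ B : Set V} (h : IsBiclosedIn Φ B) : IsBiclosedIn Φ (Φ \ B) := by
  refine ⟨Set.sdiff_subset, h.2.2, ?_⟩
  rw [Set.sdiff_sdiff_cancel_left h.1]
  exact h.2.1

/-- Adding to the strictly one-sided part of a biclosed set an element of its two-sided part or of
the two-sided part of its complement does not leave the one-sided part. -/
lemma IsBiclosedIn.add_smul_mem {Φ B : Set V} (hΦ : ∀ x ∈ Φ, -x ∈ Φ) (h : IsBiclosedIn Φ B)
    {x y : V} (hx : x ∈ B) (hx' : -x ∉ B) (hy : y ∈ symmPart B ∨ y ∈ symmPart (Φ \ B))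
    (c : ℝ) (hm : x + c • y ∈ Φ) : x + c • y ∈ B ∧ -(x + c • y) ∉ B := by
  wlog hc : 0 ≤ c generalizing y c
  · have := this (y := -y) (c := -c) (hy.imp neg_mem_symmPart neg_mem_symmPart)
      (by simpa using hm) (by linarith)
    simpa using this
  rcases hc.eq_or_lt with rfl | hc
  · simpa using ⟨hx, hx'⟩
  rcases hy with hy | hy
  · refine ⟨h.2.1.add_smul_mem hx hy.1 hc hm, fun hn ↦ hx' ?_⟩
    have e : -x = -(x + c • y) + c • y := by module
    rw [e]
    exact h.2.1.add_smul_mem hn hy.1 hc (by rw [← e]; exact hΦ _ (h.1 hx))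
  · constructor
    · by_contra hz
      have e : x = (x + c • y) + c • (-y) := by module
      have := h.2.2.add_smul_mem (x := x + c • y) ⟨hm, hz⟩ hy.2 hc (by rw [← e]; exact h.1 hx)
      rw [← e] at this
      exact this.2 hx
    · have e : -(x + c • y) = -x + c • (-y) := by module
      rw [e]
      exact (h.2.2.add_smul_mem (x := -x) ⟨hΦ _ (h.1 hx), hx'⟩ hy.2 hc
        (by rw [← e]; exact hΦ _ hm)).2

/-- A biclosed set may be enlarged by an open half of the two-sided part of its complement. -/
lemma IsBiclosedIn.union_pos {Φ B : Set V} (hΦ : ∀ x ∈ Φ, -x ∈ Φ) (h : IsBiclosedIn Φ B)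
    (ν : Module.Dual ℝ V) : IsBiclosedIn Φ (B ∪ {x ∈ symmPart (Φ \ B) | 0 < ν x}) := by
  have scale : ∀ {x y : V} {a b : ℝ}, 0 < a → a • x + b • y = a • (x + (b / a) • y) := by
    intro x y a b ha
    rw [smul_add, smul_smul, mul_div_cancel₀ _ ha.ne']
  have key : ∀ x ∈ B, ∀ y ∈ symmPart (Φ \ B), ∀ a b : ℝ, 0 < a → 0 < b → a • x + b • y ∈ Φ →
      a • x + b • y ∈ B := by
    intro x hx y hy a b ha hb hm
    by_contra hz
    have hxΦ := h.1 hx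
    have e : x = (1 / a) • (a • x + b • y) + (b / a) • (-y) := by
      rw [smul_add, smul_smul, smul_smul, one_div_mul_cancel ha.ne', one_smul, add_assoc, smul_neg,
        one_div_mul_eq_div, add_neg_cancel, add_zero]
    have := h.2.2 _ ⟨hm, hz⟩ _ hy.2 (1 / a) (b / a) (by positivity) (by positivity)
      (by rw [← e]; exact hxΦ)
    rw [← e] at this
    exact this.2 hx
  have symm : ∀ x ∈ symmPart (Φ \ B), ∀ y ∈ symmPart (Φ \ B), ∀ a b : ℝ, 0 < a → 0 < b →
      a • x + b • y ∈ Φ → a • x + b • y ∈ symmPart (Φ \ B) := by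
    intro x hx y hy a b ha hb hm
    refine ⟨h.2.2 _ hx.1 _ hy.1 a b ha hb hm, ?_⟩
    have e : -(a • x + b • y) = a • (-x) + b • (-y) := by module
    rw [Set.mem_neg, e]
    exact h.2.2 _ hx.2 _ hy.2 a b ha hb (by rw [← e]; exact hΦ _ hm)
  refine ⟨Set.union_subset h.1 fun x hx ↦ hx.1.1.1, ?_, ?_⟩
  · rintro x (hx | hx) y (hy | hy) a b ha hb hm
    · exact Or.inl (h.2.1 x hx y hy a b ha hb hm)
    · exact Or.inl (key x hx y hy.1 a b ha hb hm)
    · rw [add_comm] at hm ⊢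
      exact Or.inl (key y hy x hx.1 b a hb ha hm)
    · refine Or.inr ⟨symm x hx.1 y hy.1 a b ha hb hm, ?_⟩
      have := hx.2
      have := hy.2
      simp only [map_add, map_smul, smul_eq_mul]
      positivity
  · have dich : ∀ x ∈ Φ \ (B ∪ {x ∈ symmPart (Φ \ B) | 0 < ν x}),
        x ∉ B ∧ (-x ∈ B ∨ (x ∈ symmPart (Φ \ B) ∧ ν x ≤ 0)) := by
      rintro x ⟨hx, hx'⟩
      have hxB : x ∉ B := fun hB ↦ hx' (Or.inl hB)
      refine ⟨hxB, ?_⟩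
      by_cases hn : -x ∈ B
      · exact Or.inl hn
      · have hs : x ∈ symmPart (Φ \ B) := ⟨⟨hx, hxB⟩, hΦ x hx, hn⟩
        exact Or.inr ⟨hs, not_lt.mp fun h0 ↦ hx' (Or.inr ⟨hs, h0⟩)⟩
    have key' : ∀ x, -x ∈ B → ∀ y ∈ symmPart (Φ \ B), ∀ a b : ℝ, 0 < a → 0 < b →
        a • x + b • y ∈ Φ → -(a • x + b • y) ∈ B := by
      intro x hx y hy a b ha hb hm
      have e : -(a • x + b • y) = a • (-x) + b • (-y) := by module
      rw [e]
      exact key (-x) hx (-y) (neg_mem_symmPart hy) a b ha hb (by rw [← e]; exact hΦ _ hm)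
    have fin : ∀ z ∈ Φ, z ∉ B → (-z ∈ B ∨ ν z ≤ 0) →
        z ∈ Φ \ (B ∪ {x ∈ symmPart (Φ \ B) | 0 < ν x}) := by
      rintro z hz hzB h'
      refine ⟨hz, ?_⟩
      rintro (h1 | h1)
      · exact hzB h1
      · rcases h' with h' | h'
        · exact h1.1.2.2 h'
        · exact absurd h1.2 (not_lt.mpr h')
    intro x hx y hy a b ha hb hm
    obtain ⟨hxB, hx'⟩ := dich x hx
    obtain ⟨hyB, hy'⟩ := dich y hy
    refine fin _ hm (h.2.2 x ⟨hx.1, hxB⟩ y ⟨hy.1, hyB⟩ a b ha hb hm).2 ?_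
    rcases hx' with hx' | hx' <;> rcases hy' with hy' | hy'
    · left
      have e : -(a • x + b • y) = a • (-x) + b • (-y) := by module
      rw [e]
      exact h.2.1 _ hx' _ hy' a b ha hb (by rw [← e]; exact hΦ _ hm)
    · exact Or.inl (key' x hx' y hy'.1 a b ha hb hm)
    · rw [add_comm] at hm ⊢
      exact Or.inl (key' y hy' x hx'.1 b a hb ha hm)
    · right
      have := hx'.2
      have := hy'.2
      simp only [map_add, map_smul, smul_eq_mul]
      nlinarith

end BiclosedTheory

/-! ### Functionals and orthogonality for biclosed sets of roots -/

section BiclosedRoots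

open Module Set Submodule

variable {ι V V' : Type*} [Finite ι] [AddCommGroup V] [Module ℝ V] [AddCommGroup V'] [Module ℝ V']
  (P : RootPairing ι ℝ V V')

omit [Finite ι] in
lemma RootPairing.neg_mem_range_root : ∀ x ∈ range P.root, -x ∈ range P.root :=
  fun _ hx ↦ P.neg_mem_range_root_iff.mpr hx

variable {P} in
lemma RootPairing.pairing_lt_zero_of_swap {i j : ι} (h : P.pairing i j < 0) :
    P.pairing j i < 0 := by
  rw [← P.algebraMap_pairingIn ℝ] at h ⊢
  exact (P.pairingIn_lt_zero_iff ℝ).mp h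

lemma RootPairing.IsRootSystem.finite [P.IsRootSystem] : Module.Finite ℝ V :=
  ⟨by rw [← RootPairing.IsRootSystem.span_root_eq_top (P := P)]; exact fg_span (finite_range _)⟩

variable {P} {B C : Set V}

/-- A biclosed set of roots is cut out by a linear functional, up to the roots in its two-sided
part and in that of its complement. -/
lemma IsBiclosedIn.exists_dual (h : IsBiclosedIn (range P.root) B) :
    ∃ f : Dual ℝ V, (∀ x ∈ B, -x ∉ B → 0 < f x) ∧
      (∀ x, x ∈ symmPart B ∨ x ∈ symmPart (range P.root \ B) → f x = 0) := by
  classical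
  have _i : Fintype ι := Fintype.ofFinite ι
  have hneg := P.neg_mem_range_root
  -- The functional is the sum of the coroots of all one-sided roots of `B`.
  let S : Finset ι := {i | P.root i ∈ B ∧ -P.root i ∉ B}
  have hS : ∀ i, i ∈ S ↔ P.root i ∈ B ∧ -P.root i ∉ B := by simp [S]
  have hf : ∀ j, (∑ i ∈ S, P.coroot' i) (P.root j) = ∑ i ∈ S, P.pairing j i := by
    intro j
    simp [LinearMap.sum_apply]
  have hflip : ∀ j i, P.pairing j (P.reflectionPerm j i) = - P.pairing j i := by
    intro j i
    rw [P.pairing_reflectionPerm, P.pairing_reflectionPerm_self_left]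
  have hroot : ∀ j i, P.root (P.reflectionPerm j i) = P.root i + (-P.pairing i j) • P.root j := by
    intro j i
    rw [P.root_reflectionPerm, P.reflection_apply_root]
    module
  refine ⟨∑ i ∈ S, P.coroot' i, ?_, ?_⟩
  · intro x hx hx'
    obtain ⟨j, rfl⟩ := h.1 hx
    rw [hf]
    let N := S.filter fun i ↦ P.pairing j i < 0
    have hNS : N ⊆ S := Finset.filter_subset _ _
    have hinj : Set.InjOn (P.reflectionPerm j) (N : Set ι) := (P.reflectionPerm j).injective.injOn
    have himg : N.image (P.reflectionPerm j) ⊆ S \ N := by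
      intro k hk
      obtain ⟨i, hi, rfl⟩ := Finset.mem_image.mp hk
      obtain ⟨hiS, hi0⟩ := Finset.mem_filter.mp hi
      rw [hS] at hiS
      have hi0' : P.pairing i j < 0 := RootPairing.pairing_lt_zero_of_swap hi0
      refine Finset.mem_sdiff.mpr ⟨?_, ?_⟩
      · rw [hS, hroot]
        refine ⟨h.2.1.add_smul_mem hiS.1 hx (by linarith) ?_, fun hn ↦ hiS.2 ?_⟩
        · rw [← hroot]; exact ⟨_, rfl⟩
        · have e : -P.root i = -(P.root i + (-P.pairing i j) • P.root j)
              + (-P.pairing i j) • P.root j := by module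
          rw [e]
          exact h.2.1.add_smul_mem hn hx (by linarith) (by rw [← e]; exact hneg _ ⟨i, rfl⟩)
      · intro hk
        have := (Finset.mem_filter.mp hk).2
        rw [hflip] at this
        linarith
    rw [← Finset.sum_sdiff hNS, ← Finset.sum_sdiff himg, Finset.sum_image hinj]
    simp only [hflip, Finset.sum_neg_distrib, neg_add_cancel_right]
    refine Finset.sum_pos' (fun i hi ↦ ?_) ⟨j, ?_, by simp⟩
    · simp only [Finset.mem_sdiff] at hi
      exact not_lt.mp fun h0 ↦ hi.1.2 (Finset.mem_filter.mpr ⟨hi.1.1, h0⟩)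
    · have hjS : j ∈ S := (hS j).mpr ⟨hx, hx'⟩
      simp only [Finset.mem_sdiff, hjS, true_and, Finset.mem_image, not_exists, not_and, N,
        Finset.mem_filter, P.pairing_same]
      refine ⟨by norm_num, fun i hi he ↦ ?_⟩
      have : i = P.reflectionPerm j j := by
        rw [← P.reflectionPerm_self j i, he]
      have hri : P.root i = -P.root j := by simp [this]
      rw [hS, hri] at hi
      exact hx' hi.1.1
  · intro x hx
    have hxΦ : x ∈ range P.root := hx.elim (fun h' ↦ h.1 h'.1) fun h' ↦ h'.1.1
    obtain ⟨j, rfl⟩ := hxΦ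
    have hmem : ∀ i, i ∈ S → P.reflectionPerm j i ∈ S := by
      intro i hi
      rw [hS] at hi
      rw [hS, hroot]
      exact h.add_smul_mem hneg hi.1 hi.2 hx _ (by rw [← hroot]; exact ⟨_, rfl⟩)
    rw [hf]
    -- The reflection in root `j` now permutes `S` and changes the sign of every term, so the sum
    -- equals its own negative.
    have : ∑ i ∈ S, P.pairing j i = ∑ i ∈ S, P.pairing j (P.reflectionPerm j i) := by
      refine Finset.sum_equiv (P.reflectionPerm j) (fun i ↦ ⟨hmem i, fun hi ↦ ?_⟩)
        fun i _ ↦ by rw [P.reflectionPerm_self]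
      simpa using hmem _ hi
    simp only [hflip, Finset.sum_neg_distrib] at this
    linarith

-- If the pairing were nonzero, a change of sign of `β = P.root j` makes it negative, and the
-- reflection `y = α + c β` of `α = P.root i` has `c > 0`. If `y ∈ B`, then `α = y + c (-β)` lies in
-- `B`; otherwise `β` is a positive combination of `y` and `-α`, hence lies in the complement. Both
-- are absurd.
omit [Finite ι] in
lemma IsBiclosedIn.pairing_eq_zero (h : IsBiclosedIn (range P.root) B) {i j : ι}
    (hi : P.root i ∈ symmPart (range P.root \ B)) (hj : P.root j ∈ symmPart B) :
    P.pairing i j = 0 := by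
  by_contra hne
  have hneg := P.neg_mem_range_root
  wlog hlt : P.pairing i j < 0 generalizing j
  · refine this (j := P.reflectionPerm j j) (by simpa using neg_mem_symmPart hj)
      (by simpa using hne) ?_
    rw [P.pairing_reflectionPerm_self_right]
    have := lt_of_le_of_ne (not_lt.mp hlt) (Ne.symm hne)
    linarith
  set c := -P.pairing i j with hc
  have hc0 : 0 < c := by linarith
  set y := P.root i + c • P.root j with hy
  have hyΦ : y ∈ range P.root := ⟨P.reflectionPerm j i, by
    rw [P.root_reflectionPerm, P.reflection_apply_root, hy, hc]; module⟩
  have hiΦ : P.root i ∈ range P.root := ⟨i, rfl⟩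
  have h1 : y ∉ B := by
    intro hyB
    have e : P.root i = y + c • (-P.root j) := by rw [hy]; module
    have := h.2.1.add_smul_mem hyB hj.2 hc0 (by rw [← e]; exact hiΦ)
    rw [← e] at this
    exact hi.1.2 this
  have e : P.root j = (1 / c) • y + (1 / c) • (-P.root i) := by
    rw [hy, smul_add, smul_smul, one_div_mul_cancel hc0.ne']
    module
  have := h.2.2 y ⟨hyΦ, h1⟩ _ hi.2 (1 / c) (1 / c) (by positivity) (by positivity)
    (by rw [← e]; exact ⟨j, rfl⟩)
  rw [← e] at this
  exact this.2 hj.1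

omit [Finite ι] in
/-- The linear functional of `IsBiclosedIn.exists_dual` detects the one-sided part. -/
lemma mem_of_dual_pos {f : Dual ℝ V}
    (h1 : ∀ x ∈ B, -x ∉ B → 0 < f x)
    (h2 : ∀ x, x ∈ symmPart B ∨ x ∈ symmPart (range P.root \ B) → f x = 0)
    {x : V} (hx : x ∈ range P.root) (hf : 0 < f x) : x ∈ B ∧ -x ∉ B := by
  have hneg := P.neg_mem_range_root
  by_cases hB : x ∈ B <;> by_cases hB' : -x ∈ B
  · have := h2 x (Or.inl ⟨hB, hB'⟩); linarith
  · exact ⟨hB, hB'⟩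
  · have := h1 (-x) hB' (by simpa using hB)
    rw [map_neg] at this
    linarith
  · have := h2 x (Or.inr ⟨⟨hx, hB⟩, hneg x hx, hB'⟩); linarith

omit [Finite ι] in
lemma mem_or_mem_of_dual_eq_zero {f : Dual ℝ V}
    (h1 : ∀ x ∈ B, -x ∉ B → 0 < f x)
    {x : V} (hx : x ∈ range P.root) (hf : f x = 0) :
    x ∈ symmPart B ∨ x ∈ symmPart (range P.root \ B) := by
  have hneg := P.neg_mem_range_root
  by_cases hB : x ∈ B <;> by_cases hB' : -x ∈ B
  · exact Or.inl ⟨hB, hB'⟩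
  · have := h1 x hB hB'; linarith
  · have := h1 (-x) hB' (by simpa using hB)
    rw [map_neg] at this
    linarith
  · exact Or.inr ⟨⟨hx, hB⟩, hneg x hx, hB'⟩

/-- The two-sided part of a biclosed set is the trace of a subspace. -/
lemma IsBiclosedIn.mem_symmPart_of_mem_span (h : IsBiclosedIn (range P.root) B) {x : V}
    (hx : x ∈ range P.root) (hs : x ∈ span ℝ (symmPart B)) : x ∈ symmPart B := by
  obtain ⟨f, h1, h2⟩ := h.exists_dual
  have hf : f x = 0 := by
    have : span ℝ (symmPart B) ≤ LinearMap.ker f :=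
      span_le.mpr fun y hy ↦ LinearMap.mem_ker.mpr (h2 y (Or.inl hy))
    exact LinearMap.mem_ker.mp (this hs)
  refine (mem_or_mem_of_dual_eq_zero h1 hx hf).resolve_right fun hfree ↦ ?_
  obtain ⟨i, rfl⟩ := hx
  -- Otherwise the root is orthogonal to the whole span, hence to itself.
  have : span ℝ (symmPart B) ≤ LinearMap.ker (P.coroot' i) := by
    refine span_le.mpr fun y hy ↦ LinearMap.mem_ker.mpr ?_
    obtain ⟨j, rfl⟩ := h.1 hy.1
    rw [P.root_coroot'_eq_pairing, P.pairing_eq_zero_iff]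
    exact h.pairing_eq_zero hfree hy
  simpa using LinearMap.mem_ker.mp (this hs)

lemma IsBiclosedIn.span_symmPart_lt (hB : IsBiclosedIn (range P.root) B)
    (hC : IsBiclosedIn (range P.root) C) (hlt : symmPart B ⊂ symmPart C) :
    span ℝ (symmPart B) < span ℝ (symmPart C) := by
  refine lt_of_le_of_ne (span_mono hlt.1) fun he ↦ hlt.2 fun x hx ↦ ?_
  exact hB.mem_symmPart_of_mem_span (hC.1 hx.1) (he ▸ subset_span hx)

variable [P.IsRootSystem]

/-- The two spans are orthogonal for `P.RootForm`, which is positive definite. -/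
lemma IsBiclosedIn.disjoint_span (h : IsBiclosedIn (range P.root) B) :
    Disjoint (span ℝ (symmPart B)) (span ℝ (symmPart (range P.root \ B))) := by
  have _i : Fintype ι := Fintype.ofFinite ι
  rw [Submodule.disjoint_def]
  intro x hx hx'
  refine P.eq_zero_of_mem_rootSpan_of_rootForm_self_eq_zero (by simp) ?_
  have key : ∀ i, P.root i ∈ symmPart (range P.root \ B) →
      ∀ y ∈ span ℝ (symmPart B), P.RootForm (P.root i) y = 0 := by
    intro i hi
    have : span ℝ (symmPart B) ≤ LinearMap.ker (P.RootForm (P.root i)) := by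
      refine span_le.mpr fun y hy ↦ LinearMap.mem_ker.mpr ?_
      obtain ⟨j, rfl⟩ := h.1 hy.1
      exact (P.toInvariantForm.apply_root_root_zero_iff i j).mpr (h.pairing_eq_zero hi hy)
    exact fun y hy ↦ LinearMap.mem_ker.mp (this hy)
  have : span ℝ (symmPart (range P.root \ B)) ≤ LinearMap.ker (P.RootForm.flip x) := by
    refine span_le.mpr fun y hy ↦ LinearMap.mem_ker.mpr ?_
    obtain ⟨i, rfl⟩ := hy.1.1
    exact key i hy x hx
  exact LinearMap.mem_ker.mp (this hx')

lemma IsBiclosedIn.finrank_add_le (h : IsBiclosedIn (range P.root) B) :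
    finrank ℝ (span ℝ (symmPart B)) + finrank ℝ (span ℝ (symmPart (range P.root \ B)))
      ≤ finrank ℝ V := by
  have _i : Module.Finite ℝ V := RootPairing.IsRootSystem.finite P
  exact Submodule.finrank_add_finrank_le_of_disjoint h.disjoint_span

/-- In case of equality the spans fill `V`, so the functional of `IsBiclosedIn.exists_dual` is zero
and no root is one-sided. The roots then split into two orthogonal sets, against irreducibility. -/
lemma IsBiclosedIn.finrank_add_lt [P.IsIrreducible] (h : IsBiclosedIn (range P.root) B)
    (h0 : B ≠ ∅) (h1 : B ≠ range P.root) :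
    finrank ℝ (span ℝ (symmPart B)) + finrank ℝ (span ℝ (symmPart (range P.root \ B)))
      < finrank ℝ V := by
  have _i : Module.Finite ℝ V := RootPairing.IsRootSystem.finite P
  refine lt_of_le_of_ne h.finrank_add_le fun he ↦ ?_
  have htop := Submodule.eq_top_of_disjoint _ _ he.ge h.disjoint_span
  obtain ⟨f, hf1, hf2⟩ := h.exists_dual
  have hf : ∀ x, f x = 0 := by
    have : (⊤ : Submodule ℝ V) ≤ LinearMap.ker f := by
      rw [← htop]
      exact sup_le (span_le.mpr fun x hx ↦ hf2 x (Or.inl hx))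
        (span_le.mpr fun x hx ↦ hf2 x (Or.inr hx))
    exact fun x ↦ LinearMap.mem_ker.mp (this mem_top)
  have hcover : ∀ x ∈ range P.root, x ∈ symmPart B ∨ x ∈ symmPart (range P.root \ B) :=
    fun x hx ↦ mem_or_mem_of_dual_eq_zero hf1 hx (hf x)
  have himg : P.root '' {i | P.root i ∈ symmPart B} = symmPart B := by
    ext x
    constructor
    · rintro ⟨i, hi, rfl⟩; exact hi
    · intro hx
      obtain ⟨i, rfl⟩ := h.1 hx.1
      exact ⟨i, hx, rfl⟩
  obtain ⟨x, hx⟩ := Set.nonempty_iff_ne_empty.mpr h0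
  have hxs : x ∈ symmPart B := (hcover x (h.1 hx)).resolve_right fun h' ↦ h'.1.2 hx
  have hne : {i | P.root i ∈ symmPart B}.Nonempty := by
    obtain ⟨i, rfl⟩ := h.1 hx
    exact ⟨i, hxs⟩
  have := P.span_root_image_eq_top_of_forall_orthogonal _ hne (by
    intro j hj i hi
    rw [himg] at hj
    have hj' := (hcover _ ⟨j, rfl⟩).resolve_left fun h' ↦ hj (subset_span h')
    have := h.pairing_eq_zero hj' hi
    exact ⟨this, P.pairing_eq_zero_iff.mp this⟩)
  rw [himg] at this
  refine h1 (Subset.antisymm h.1 fun y hy ↦ ?_)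
  exact (h.mem_symmPart_of_mem_span hy (this ▸ mem_top)).1

end BiclosedRoots

/-! ### Ranks of biclosed sets and refinement of steps -/

section BiclosedRank

open Module Set Submodule

variable {ι V V' : Type*} [Finite ι] [AddCommGroup V] [Module ℝ V] [AddCommGroup V'] [Module ℝ V']
  {P : RootPairing ι ℝ V V'} [P.IsRootSystem] {B C : Set V}

/-- A step labelled `0` at which the rank drops by at least two can be refined. -/
lemma IsBiclosedIn.exists_between_zero (hB : IsBiclosedIn (range P.root) B)
    (hC : IsBiclosedIn (range P.root) C) (hBC : B ⊂ C) (hstep : StepRel 0 B C)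
    (hrk : finrank ℝ (span ℝ (symmPart (range P.root \ C))) + 2 ≤
      finrank ℝ (span ℝ (symmPart (range P.root \ B)))) :
    ∃ D, IsBiclosedIn (range P.root) D ∧ B ⊂ D ∧ D ⊂ C := by
  have _i : Module.Finite ℝ V := RootPairing.IsRootSystem.finite P
  have hneg := P.neg_mem_range_root
  have hsymm := hstep.symmPart_eq hBC.1
  rw [stepRel_zero] at hstep
  set F := symmPart (range P.root \ B) with hF
  set U := span ℝ F with hU
  set K := span ℝ (symmPart (range P.root \ C)) with hK
  obtain ⟨μ, h1, h2⟩ := hC.exists_dual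
  have hFC : ∀ x ∈ F, x ∈ C → 0 < μ x := fun x hx hxC ↦ h1 x hxC (hstep x hxC hx.1.2)
  have hCF : ∀ x ∈ F, 0 < μ x → x ∈ C := fun x hx h ↦ (mem_of_dual_pos h1 h2 hx.1.1 h).1
  have hF0 : ∀ x ∈ F, μ x = 0 → x ∈ K := by
    intro x hx h0
    rcases mem_or_mem_of_dual_eq_zero h1 hx.1.1 h0 with h | h
    · rw [hsymm] at h
      exact absurd h.1 hx.1.2
    · exact subset_span h
  have hnew : ∀ x ∈ C, x ∉ B → x ∈ F := fun x hx hxB ↦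
    ⟨⟨hC.1 hx, hxB⟩, hneg x (hC.1 hx), fun h ↦ hstep x hx hxB (hBC.1 h)⟩
  have hKU : K ≤ U := by
    refine span_mono fun x hx ↦ ⟨⟨hx.1.1, fun h ↦ hx.1.2 (hBC.1 h)⟩, hx.2.1,
      fun h ↦ hx.2.2 (hBC.1 h)⟩
  have hKμ : K ≤ LinearMap.ker μ := span_le.mpr fun x hx ↦ h2 x (Or.inr hx)
  -- Intersecting with a hyperplane costs at most one dimension, while `U` exceeds `K` by at least
  -- two.
  obtain ⟨v, ⟨hvU, hvμ⟩, hvK⟩ : ∃ v ∈ U ⊓ LinearMap.ker μ, v ∉ K := by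
    by_contra! hle
    have h3 : finrank ℝ (U ⊓ LinearMap.ker μ : Submodule ℝ V) ≤ finrank ℝ K :=
      Submodule.finrank_mono hle
    have h4 := Submodule.finrank_sup_add_finrank_inf_eq U (LinearMap.ker μ)
    have h5 := Submodule.finrank_le (U ⊔ LinearMap.ker μ)
    have h6 := LinearMap.finrank_range_add_finrank_ker μ
    have h7 : finrank ℝ (LinearMap.range μ) ≤ 1 := by
      simpa using Submodule.finrank_le (LinearMap.range μ)
    omega
  obtain ⟨g, hgv, hgK⟩ := Submodule.exists_le_ker_of_notMem hvK
  have hTfin : {x ∈ F | 0 < μ x}.Finite := (finite_range P.root).subset fun x hx ↦ hx.1.1.1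
  have hTne : {x ∈ F | 0 < μ x}.Nonempty := by
    obtain ⟨x, hx, hxB⟩ := exists_of_ssubset hBC
    exact ⟨x, hnew x hx hxB, hFC x (hnew x hx hxB) hx⟩
  -- Tilt `μ` by `g` until the half-space first meets a new root. With the maximal ratio, `ν` is
  -- nonnegative on all new roots and vanishes at `x₀`, which is thus left out. As `ν v = -g v ≠ 0`,
  -- some root of `F` is still positive for `ν`.
  obtain ⟨x₀, ⟨hx₀F, hx₀⟩, hmax⟩ := exists_max_image _ (fun x ↦ g x / μ x) hTfin hTne
  set ν : Dual ℝ V := (g x₀ / μ x₀) • μ - g with hν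
  have hνT : ∀ x ∈ F, 0 < μ x → 0 ≤ ν x := by
    intro x hx h0
    have := (div_le_iff₀ h0).mp (hmax x ⟨hx, h0⟩)
    simpa [hν] using this
  have hνx₀ : ν x₀ = 0 := by simp [hν, hx₀.ne']
  have hνK : ∀ x ∈ K, ν x = 0 := by
    intro x hx
    simp [hν, LinearMap.mem_ker.mp (hKμ hx), LinearMap.mem_ker.mp (hgK hx)]
  have hνμ : ∀ x ∈ F, 0 < ν x → 0 < μ x := by
    intro x hx h0
    by_contra hle
    rcases (not_lt.mp hle).lt_or_eq with h | h
    · have := hνT (-x) (neg_mem_symmPart hx) (by simpa using h)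
      rw [map_neg] at this
      linarith
    · exact h0.ne' (hνK x (hF0 x hx h))
  obtain ⟨y, hyF, hy⟩ : ∃ y ∈ F, 0 < ν y := by
    by_contra! hle
    have : U ≤ LinearMap.ker ν := by
      refine span_le.mpr fun x hx ↦ LinearMap.mem_ker.mpr (le_antisymm (hle x hx) ?_)
      have := hle (-x) (neg_mem_symmPart hx)
      rw [map_neg] at this
      linarith
    have h0 := LinearMap.mem_ker.mp (this hvU)
    rw [hν] at h0
    simp [LinearMap.mem_ker.mp hvμ] at h0
    exact hgv h0
  refine ⟨_, hB.union_pos hneg ν, ⟨subset_union_left, fun hle ↦ ?_⟩, ⟨?_, fun hle ↦ ?_⟩⟩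
  · exact hyF.1.2 (hle (Or.inr ⟨hyF, hy⟩))
  · rintro x (hx | hx)
    · exact hBC.1 hx
    · exact hCF x hx.1 (hνμ x hx.1 hx.2)
  · rcases hle (hCF x₀ hx₀F hx₀) with h | h
    · exact hx₀F.1.2 h
    · exact h.2.ne' hνx₀

variable (P) in
/-- The number of steps labelled `ε` of a maximal admissible chain before the biclosed set `B`. -/
noncomputable def letterRank (ε : Fin 2) (B : Set V) : ℕ :=
  if ε = 1 then finrank ℝ (span ℝ (symmPart B))
  else finrank ℝ V - finrank ℝ (span ℝ (symmPart (range P.root \ B)))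

omit [Finite ι] [P.IsRootSystem] in
lemma diff_ssubset_diff (hC : IsBiclosedIn (range P.root) C) (hBC : B ⊂ C) :
    range P.root \ C ⊂ range P.root \ B := by
  refine ⟨sdiff_subset_sdiff_right hBC.1, fun hle ↦ ?_⟩
  obtain ⟨x, hx, hxB⟩ := exists_of_ssubset hBC
  exact (hle ⟨hC.1 hx, hxB⟩).2 hx

omit [Finite ι] [P.IsRootSystem] in
lemma symmPart_range_root : symmPart (range P.root) = range P.root := by
  ext x
  exact ⟨fun h ↦ h.1, fun h ↦ ⟨h, P.neg_mem_range_root x h⟩⟩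

omit [Module ℝ V] in
lemma symmPart_empty : symmPart (∅ : Set V) = ∅ := by simp [symmPart]

omit [Finite ι] in
lemma letterRank_empty (ε : Fin 2) : letterRank P ε ∅ = 0 := by
  fin_cases ε <;> simp only [letterRank]
  · rw [sdiff_empty, symmPart_range_root, RootPairing.IsRootSystem.span_root_eq_top]
    simp
  · rw [symmPart_empty, span_empty]
    simp

omit [Finite ι] in
lemma letterRank_range (ε : Fin 2) : letterRank P ε (range P.root) = finrank ℝ V := by
  fin_cases ε <;> simp only [letterRank]
  · rw [sdiff_self, symmPart_empty, span_empty]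
    simp
  · rw [symmPart_range_root, RootPairing.IsRootSystem.span_root_eq_top]
    simp

omit [Finite ι] [P.IsRootSystem] in
lemma letterRank_eq (hBC : B ⊂ C) {ε δ : Fin 2} (hne : δ ≠ ε) (h : StepRel ε B C) :
    letterRank P δ B = letterRank P δ C := by
  have hneg := P.neg_mem_range_root
  fin_cases ε <;> fin_cases δ <;> simp [letterRank] at hne h ⊢
  · rw [h.symmPart_eq hBC.1]
  · rw [h.zero_diff.symmPart_eq (sdiff_subset_sdiff_right hBC.1)]

lemma letterRank_lt (hB : IsBiclosedIn (range P.root) B) (hC : IsBiclosedIn (range P.root) C)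
    (hBC : B ⊂ C) {ε : Fin 2} (h : StepRel ε B C) :
    letterRank P ε B < letterRank P ε C := by
  have _i : Module.Finite ℝ V := RootPairing.IsRootSystem.finite P
  have hneg := P.neg_mem_range_root
  fin_cases ε <;> simp [letterRank] at h ⊢
  · have h1 := (h.one_diff hneg).symmPart_ssubset (diff_ssubset_diff hC hBC)
    have h2 := Submodule.finrank_lt_finrank_of_lt (hC.diff.span_symmPart_lt hB.diff h1)
    have h3 := Submodule.finrank_le (span ℝ (symmPart (range P.root \ B)))
    omega
  · exact Submodule.finrank_lt_finrank_of_lt (hB.span_symmPart_lt hC (h.symmPart_ssubset hBC))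

/-- Label `1` reduces to label `0` by passing to complements. -/
lemma IsBiclosedIn.exists_between (hB : IsBiclosedIn (range P.root) B) (hC : IsBiclosedIn (range P.root) C)
    (hBC : B ⊂ C) {ε : Fin 2} (h : StepRel ε B C)
    (hrk : letterRank P ε B + 2 ≤ letterRank P ε C) :
    ∃ D, IsBiclosedIn (range P.root) D ∧ B ⊂ D ∧ D ⊂ C := by
  have hneg := P.neg_mem_range_root
  fin_cases ε <;> simp [letterRank] at h hrk
  · exact hB.exists_between_zero hC hBC h (by omega)
  · have hssub := diff_ssubset_diff hC hBC
    obtain ⟨D, hD, h1, h2⟩ := hC.diff.exists_between_zero hB.diff hssub h.zero_diff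
      (by rwa [sdiff_sdiff_cancel_left hB.1, sdiff_sdiff_cancel_left hC.1])
    refine ⟨_, hD.diff, ?_, ?_⟩
    · have := diff_ssubset_diff hB.diff h2
      rwa [sdiff_sdiff_cancel_left hB.1] at this
    · have := diff_ssubset_diff hD h1
      rwa [sdiff_sdiff_cancel_left hC.1] at this

lemma letterRank_one_lt [P.IsIrreducible] (h : IsBiclosedIn (range P.root) B)
    (h0 : B ≠ ∅) (h1 : B ≠ range P.root) : letterRank P 1 B < letterRank P 0 B := by
  have := h.finrank_add_lt h0 h1
  simp [letterRank]
  omega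

end BiclosedRank

/-! ### Chains as lists of labelled steps -/

section ChainWords

open Module Set

variable {V : Type*} [AddCommGroup V] [Module ℝ V]

/-- `L` lists the labels and the members after `A` of an admissible chain of biclosed sets from `A`
to `B`. -/
def ChainPath (Φ : Set V) : Set V → List (Fin 2 × Set V) → Set V → Prop
  | A, [], B => A = B
  | A, (ε, D) :: L, B => (IsBiclosedIn Φ D ∧ A ⊂ D ∧ StepRel ε A D) ∧ ChainPath Φ D L B

variable {Φ : Set V}

lemma chainPath_append {L M : List (Fin 2 × Set V)} {A B : Set V} :
    ChainPath Φ A (L ++ M) B ↔ ∃ D, ChainPath Φ A L D ∧ ChainPath Φ D M B := by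
  induction L generalizing A with
  | nil => simp [ChainPath]
  | cons p L ih =>
    simp only [List.cons_append, ChainPath, ih]
    constructor
    · rintro ⟨h, D, h1, h2⟩
      exact ⟨D, ⟨h, h1⟩, h2⟩
    · rintro ⟨D, ⟨h, h1⟩, h2⟩
      exact ⟨h, D, h1, h2⟩

lemma ChainPath.isBiclosedIn {L : List (Fin 2 × Set V)} {A B : Set V} (hA : IsBiclosedIn Φ A)
    (h : ChainPath Φ A L B) : IsBiclosedIn Φ B := by
  induction L generalizing A with
  | nil => exact h ▸ hA
  | cons p L ih => exact ih h.1.1 h.2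

lemma ChainPath.subset {L : List (Fin 2 × Set V)} {A B : Set V}
    (h : ChainPath Φ A L B) : A ⊆ B := by
  induction L generalizing A with
  | nil => exact Eq.subset h
  | cons p L ih => exact h.1.2.1.1.trans (ih h.2)

lemma ChainPath.ne {L : List (Fin 2 × Set V)} {A B : Set V}
    (h : ChainPath Φ A L B) (hL : L ≠ []) : A ≠ B := by
  cases L with
  | nil => exact absurd rfl hL
  | cons p L => exact (h.1.2.1.trans_subset h.2.subset).ne

variable (Φ) in
/-- `w` is the word of labels of an admissible chain of biclosed sets from `A` to `B`. -/
def HasWord (A : Set V) (w : List (Fin 2)) (B : Set V) : Prop :=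
  ∃ L, ChainPath Φ A L B ∧ L.map Prod.fst = w

lemma hasWord_append {v w : List (Fin 2)} {A B : Set V} :
    HasWord Φ A (v ++ w) B ↔ ∃ D, HasWord Φ A v D ∧ HasWord Φ D w B := by
  constructor
  · rintro ⟨L, h, hL⟩
    obtain ⟨L₁, L₂, rfl, rfl, rfl⟩ := List.map_eq_append_iff.mp hL
    obtain ⟨D, h1, h2⟩ := chainPath_append.mp h
    exact ⟨D, ⟨_, h1, rfl⟩, _, h2, rfl⟩
  · rintro ⟨D, ⟨L₁, h1, rfl⟩, L₂, h2, rfl⟩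
    exact ⟨L₁ ++ L₂, chainPath_append.mpr ⟨D, h1, h2⟩, by simp⟩

lemma hasWord_cons {ε : Fin 2} {w : List (Fin 2)} {A B : Set V} :
    HasWord Φ A (ε :: w) B ↔
      ∃ D, (IsBiclosedIn Φ D ∧ A ⊂ D ∧ StepRel ε A D) ∧ HasWord Φ D w B := by
  constructor
  · rintro ⟨_ | ⟨⟨δ, D⟩, L⟩, h, hL⟩
    · simp at hL
    · simp only [List.map_cons, List.cons.injEq] at hL
      obtain ⟨rfl, hL⟩ := hL
      exact ⟨D, h.1, L, h.2, hL⟩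
  · rintro ⟨D, h, L, h', rfl⟩
    exact ⟨(ε, D) :: L, ⟨h, h'⟩, by simp⟩

lemma HasWord.merge {m : ℕ} {ε : Fin 2} {A B : Set V}
    (h : HasWord Φ A (List.replicate (m + 1) ε) B) : HasWord Φ A [ε] B := by
  induction m generalizing A with
  | zero => exact h
  | succ m ih =>
    obtain ⟨D, ⟨-, h2, h3⟩, h⟩ := hasWord_cons.mp h
    obtain ⟨E, ⟨h1', h2', h3'⟩, h⟩ := hasWord_cons.mp (ih h)
    exact hasWord_cons.mpr ⟨E, ⟨h1', h2'.trans' h2, h3.trans h3'⟩, h⟩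

lemma HasWord.map_fst {blocks : List (Fin 2 × ℕ)} (hb : ∀ b ∈ blocks, 0 < b.2) {A B : Set V}
    (h : HasWord Φ A (blocks.flatMap fun b => List.replicate b.2 b.1) B) :
    HasWord Φ A (blocks.map Prod.fst) B := by
  induction blocks generalizing A with
  | nil => exact h
  | cons b blocks ih =>
    obtain ⟨ε, m⟩ := b
    rw [List.flatMap_cons] at h
    obtain ⟨D, h1, h2⟩ := hasWord_append.mp h
    obtain ⟨m, rfl⟩ : ∃ k, m = k + 1 := Nat.exists_eq_succ_of_ne_zero (hb (ε, m) (by simp)).ne'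
    rw [List.map_cons, ← List.singleton_append]
    exact hasWord_append.mpr ⟨D, h1.merge, ih (fun b hb' ↦ hb b (List.mem_cons_of_mem _ hb')) h2⟩

lemma exists_chainPath {k : ℕ} (B : Fin (k + 1) → Set V) (hB : ∀ i, IsBiclosedIn Φ (B i))
    (hs : ∀ i : Fin k, B i.castSucc ⊂ B i.succ)
    (ha : ∀ i : Fin k, IsAdmissiblePair (B i.castSucc) (B i.succ)) :
    ∃ L, ChainPath Φ (B 0) L (B (Fin.last k)) ∧ L.map Prod.fst = signature B ∧
      range B = insert (B 0) {S | S ∈ L.map Prod.snd} := by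
  induction k with
  | zero => exact ⟨[], rfl, by simp [signature], by
      ext S; simp [eq_comm]⟩
  | succ k ih =>
    obtain ⟨L, h1, h2, h3⟩ := ih (fun i ↦ B i.succ) (fun i ↦ hB _) (fun i ↦ hs i.succ)
      fun i ↦ ha i.succ
    classical
    refine ⟨(if B 1 \ B 0 ⊆ -B 0 then 1 else 0, B 1) :: L, ⟨⟨hB _, hs 0, ?_⟩, h1⟩, ?_, ?_⟩
    · split_ifs with h
      · simpa [StepRel] using h
      · have := isAdmissiblePair_iff.mp (ha 0)
        refine this.resolve_left ?_
        simpa [StepRel] using h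
    · rw [List.map_cons, h2]
      unfold signature
      rw [List.ofFn_succ]
      rfl
    · rw [← Fin.cons_self_tail B, Fin.range_cons, Fin.tail_def, h3]
      ext S
      simp

lemma ChainPath.exists_fin {L : List (Fin 2 × Set V)} {A A' : Set V} (hA : IsBiclosedIn Φ A)
    (h : ChainPath Φ A L A') :
    ∃ B : Fin (L.length + 1) → Set V, B 0 = A ∧ B (Fin.last _) = A' ∧
      (∀ i, IsBiclosedIn Φ (B i)) ∧ (∀ i : Fin L.length, B i.castSucc ⊂ B i.succ) ∧
      (∀ i : Fin L.length, IsAdmissiblePair (B i.castSucc) (B i.succ)) ∧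
      signature B = L.map Prod.fst ∧ range B = insert A {S | S ∈ L.map Prod.snd} := by
  induction L generalizing A with
  | nil => exact ⟨fun _ ↦ A, rfl, h, fun _ ↦ hA, fun i ↦ i.elim0, fun i ↦ i.elim0,
      by simp [signature], by simp⟩
  | cons p L ih =>
    obtain ⟨ε, D⟩ := p
    obtain ⟨⟨h1, h2, h3⟩, h⟩ := h
    obtain ⟨B, rfl, b2, b3, b4, b5, b6, b7⟩ := ih h1 h
    refine ⟨Fin.cons A B, rfl, ?_, Fin.cases hA b3, Fin.cases h2 b4, ?_, ?_, ?_⟩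
    · rw [← b2]; rfl
    · refine fun i ↦ Fin.cases (isAdmissiblePair_iff.mpr ?_) b5 i
      fin_cases ε
      · exact Or.inr h3
      · exact Or.inl h3
    · classical
      unfold signature at b6 ⊢
      rw [List.map_cons, ← b6]
      refine (List.ofFn_succ ..).trans ?_
      congr 1
      -- The signature recovers the given label because the two cases exclude each other on a strict
      -- inclusion.
      have h3' : B 0 \ A ⊆ -A ↔ StepRel 1 A (B 0) := by simp [StepRel]
      change (if B 0 \ A ⊆ -A then (1 : Fin 2) else 0) = ε
      rw [h3']
      fin_cases ε
      · exact if_neg (h3.not_one h2)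
      · exact if_pos h3
    · rw [Fin.range_cons, b7]
      ext S
      simp

lemma isBiclosedIn_empty : IsBiclosedIn Φ ∅ :=
  ⟨empty_subset _, fun _ h ↦ h.elim, by
    rw [sdiff_empty]
    exact fun _ _ _ _ _ _ _ _ h ↦ h⟩

lemma exists_isAdmissibleChain_iff {w : List (Fin 2)} :
    (∃ (k : ℕ) (B : Fin (k + 1) → Set V), IsAdmissibleChain Φ B ∧ signature B = w) ↔
      HasWord Φ ∅ w Φ := by
  constructor
  · rintro ⟨k, B, h, rfl⟩
    obtain ⟨L, h1, h2, -⟩ := exists_chainPath B h.biclosed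
      (fun i ↦ h.strictMono Fin.castSucc_lt_succ) h.admissible
    rw [h.zero, h.last] at h1
    exact ⟨L, h1, h2⟩
  · rintro ⟨L, h, rfl⟩
    obtain ⟨B, b1, b2, b3, b4, b5, b6, -⟩ := h.exists_fin isBiclosedIn_empty
    exact ⟨_, B, ⟨b1, b2, Fin.strictMono_iff_lt_succ.mpr b4, b3, b5⟩, b6⟩

lemma count_zero_add_count_one (w : List (Fin 2)) : w.count 0 + w.count 1 = w.length := by
  induction w with
  | nil => rfl
  | cons ε w ih => fin_cases ε <;> simp <;> omega

end ChainWords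

/-! ### From chains to Dyck words -/

section ChainLength

open Module Set

variable {ι V V' : Type*} [Finite ι] [AddCommGroup V] [Module ℝ V] [AddCommGroup V'] [Module ℝ V']
  {P : RootPairing ι ℝ V V'} [P.IsRootSystem]

lemma HasWord.letterRank_add_count_le {A B : Set V} {w : List (Fin 2)}
    (hA : IsBiclosedIn (range P.root) A) (h : HasWord (range P.root) A w B) (ε : Fin 2) :
    letterRank P ε A + w.count ε ≤ letterRank P ε B := by
  induction w generalizing A with
  | nil =>
    obtain ⟨L, h, hL⟩ := h
    obtain rfl := List.map_eq_nil_iff.mp hL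
    simp [show A = B from h]
  | cons δ w ih =>
    obtain ⟨D, ⟨h1, h2, h3⟩, h⟩ := hasWord_cons.mp h
    have := ih h1 h
    rw [List.count_cons]
    by_cases hε : ε = δ
    · subst hε
      have := letterRank_lt hA h1 h2 h3
      simp
      omega
    · have := letterRank_eq (P := P) h2 hε h3
      simp [Ne.symm hε]
      omega

/-- Each step raises only the rank of its own letter, so if the total increase exceeds the number of
steps, some step raises its rank by at least two. The inserted set splits it into two steps with the
same label. -/
lemma ChainPath.exists_refinement {A B : Set V} {L : List (Fin 2 × Set V)}
    (hA : IsBiclosedIn (range P.root) A) (h : ChainPath (range P.root) A L B)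
    (hlt : letterRank P 0 A + letterRank P 1 A + L.length < letterRank P 0 B + letterRank P 1 B) :
    ∃ L₁ ε D E L₂, L = L₁ ++ (ε, E) :: L₂ ∧
      ChainPath (range P.root) A (L₁ ++ (ε, D) :: (ε, E) :: L₂) B := by
  induction L generalizing A with
  | nil => simp [show A = B from h] at hlt
  | cons p L ih =>
    obtain ⟨ε, E⟩ := p
    obtain ⟨⟨h1, h2, h3⟩, h⟩ := h
    by_cases hr : letterRank P ε A + 2 ≤ letterRank P ε E
    · obtain ⟨D, hD, hAD, hDE⟩ := hA.exists_between h1 h2 h3 hr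
      exact ⟨[], ε, D, E, L, rfl, ⟨hD, hAD, h3.mono Subset.rfl hDE.1⟩,
        ⟨h1, hDE, h3.mono hAD.1 Subset.rfl⟩, h⟩
    · have he := letterRank_eq (P := P) (δ := 1 - ε) h2 (by fin_cases ε <;> decide) h3
      obtain ⟨L₁, δ, D, E', L₂, rfl, h'⟩ := ih h1 h (by
        simp only [List.length_cons] at hlt
        fin_cases ε <;> simp at he hr <;> omega)
      exact ⟨(ε, E) :: L₁, δ, D, E', L₂, rfl, ⟨h1, h2, h3⟩, h'⟩

lemma HasWord.count_le {w : List (Fin 2)} (h : HasWord (range P.root) ∅ w (range P.root))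
    (ε : Fin 2) : w.count ε ≤ finrank ℝ V := by
  have := h.letterRank_add_count_le isBiclosedIn_empty ε
  rw [letterRank_range] at this
  omega

lemma HasWord.length_le {w : List (Fin 2)} (h : HasWord (range P.root) ∅ w (range P.root)) :
    w.length ≤ 2 * finrank ℝ V := by
  have h0 := h.count_le 0
  have h1 := h.count_le 1
  rw [← count_zero_add_count_one]
  omega

/-- At the set `D` reached after `i` letters, the ones so far number at most `r₁(D) < r₀(D)`, and
`r₀(D)` is at most `n` minus the zeros still to come, that is, the zeros so far. -/
lemma HasWord.isExtendedDyckWord [P.IsIrreducible] {w : List (Fin 2)}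
    (h : HasWord (range P.root) ∅ w (range P.root)) (hl : w.length = 2 * finrank ℝ V) :
    IsExtendedDyckWord (finrank ℝ V) w := by
  have h0 := h.count_le 0
  have h1 := h.count_le 1
  have hc := count_zero_add_count_one w
  refine ⟨by omega, by omega, fun i hi hi' ↦ ?_⟩
  rw [← List.take_append_drop i w] at h
  obtain ⟨D, hD, hD'⟩ := hasWord_append.mp h
  obtain ⟨L, hL, hLw⟩ := hD
  have hDb := hL.isBiclosedIn isBiclosedIn_empty
  have n0 : D ≠ ∅ := by
    refine (hL.ne ?_).symm
    rintro rfl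
    have := congrArg List.length hLw
    simp at this
    omega
  have n1 : D ≠ range P.root := by
    obtain ⟨M, hM, hMw⟩ := hD'
    refine hM.ne ?_
    rintro rfl
    have := congrArg List.length hMw
    simp at this
    omega
  have r1 := HasWord.letterRank_add_count_le isBiclosedIn_empty ⟨L, hL, hLw⟩ (1 : Fin 2)
  have r2 := hD'.letterRank_add_count_le hDb (0 : Fin 2)
  have r3 := letterRank_one_lt hDb n0 n1
  have r4 : (w.take i).count 0 + (w.drop i).count 0 = w.count 0 := by
    rw [← List.count_append, List.take_append_drop]
  rw [letterRank_range] at r2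
  omega

lemma HasWord.isTrimmedDyckWord [P.IsIrreducible] {w : List (Fin 2)}
    (h : HasWord (range P.root) ∅ w (range P.root)) :
    IsTrimmedDyckWord (finrank ℝ V) w := by
  induction hd : 2 * finrank ℝ V - w.length generalizing w with
  | zero =>
    refine ⟨w.map fun ε ↦ (ε, 1), by simp, ?_, by simp [Function.comp_def]⟩
    have : ((w.map fun ε ↦ (ε, 1)).flatMap fun b => List.replicate b.2 b.1) = w := by
      rw [List.flatMap_map]
      simp
    rw [this]
    exact h.isExtendedDyckWord (le_antisymm h.length_le (by omega))
  | succ d ih =>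
    obtain ⟨L, hL, rfl⟩ := h
    obtain ⟨L₁, ε, D, E, L₂, rfl, h'⟩ := hL.exists_refinement isBiclosedIn_empty (by
      simp only [List.length_map] at hd
      simp only [letterRank_range, letterRank_empty]
      omega)
    obtain ⟨blocks, hb, hw, he⟩ := ih ⟨_, h', rfl⟩ (by simp at hd ⊢; omega)
    simp only [List.map_append, List.map_cons] at he ⊢
    -- The two copies of `ε` created by the refinement carry adjacent blocks, which are fused into
    -- one by adding their lengths.
    obtain ⟨b₁, b', rfl, e1, e2⟩ := List.map_eq_append_iff.mp he.symm
    obtain ⟨⟨ε₁, m₁⟩, b'', rfl, rfl, e2⟩ := List.map_eq_cons_iff.mp e2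
    obtain ⟨⟨ε₂, m₂⟩, b₂, rfl, e3, e4⟩ := List.map_eq_cons_iff.mp e2
    simp only at e3
    subst e3
    refine ⟨b₁ ++ (ε₂, m₁ + m₂) :: b₂, ?_, ?_, by simp [e1, e4]⟩
    · intro b hb'
      rcases List.mem_append.mp hb' with h | h
      · exact hb b (List.mem_append_left _ h)
      · rcases List.mem_cons.mp h with rfl | h
        · exact Nat.add_pos_left (hb (ε₂, m₁) (List.mem_append_right _ List.mem_cons_self)) _
        · exact hb b (List.mem_append_right _ (List.mem_cons_of_mem _ (List.mem_cons_of_mem _ h)))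
    · simp only [List.flatMap_append, List.flatMap_cons] at hw ⊢
      rw [List.replicate_add, List.append_assoc]
      exact hw

/-- No chain has more than `2n` steps, so one with `2n` steps cannot be refined; a shorter one can,
by `ChainPath.exists_refinement`. -/
lemma exists_isMaximalAdmissibleChain_iff {w : List (Fin 2)} :
    (∃ (k : ℕ) (B : Fin (k + 1) → Set V),
      IsMaximalAdmissibleChain (range P.root) B ∧ signature B = w) ↔
      HasWord (range P.root) ∅ w (range P.root) ∧ w.length = 2 * finrank ℝ V := by
  have hle : ∀ (k : ℕ) (B : Fin (k + 1) → Set V), IsAdmissibleChain (range P.root) B →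
      k ≤ 2 * finrank ℝ V := by
    intro k B hB
    have := (exists_isAdmissibleChain_iff.mp ⟨k, B, hB, rfl⟩).length_le
    simpa [signature] using this
  have hcard : ∀ (k : ℕ) (B : Fin (k + 1) → Set V), IsAdmissibleChain (range P.root) B →
      (range B).ncard = k + 1 := by
    intro k B hB
    rw [← Nat.card_coe_set_eq, Nat.card_range_of_injective hB.strictMono.injective, Nat.card_fin]
  constructor
  · rintro ⟨k, B, ⟨hB, hmax⟩, rfl⟩
    refine ⟨exists_isAdmissibleChain_iff.mp ⟨k, B, hB, rfl⟩, ?_⟩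
    obtain ⟨L, h1, h2, h3⟩ := exists_chainPath B hB.biclosed
      (fun i ↦ hB.strictMono Fin.castSucc_lt_succ) hB.admissible
    rw [hB.zero, hB.last] at h1
    rw [hB.zero] at h3
    have hkL : k = L.length := by simpa [signature] using congrArg List.length h2.symm
    rw [← h2, List.length_map, ← hkL]
    by_contra hne
    have hlt := lt_of_le_of_ne (hle k B hB) hne
    obtain ⟨L₁, ε, D, E, L₂, rfl, h'⟩ := h1.exists_refinement isBiclosedIn_empty (by
      simp only [letterRank_range, letterRank_empty]
      omega)
    obtain ⟨C, b1, b2, b3, b4, b5, -, b7⟩ := h'.exists_fin isBiclosedIn_empty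
    have hC : IsAdmissibleChain (range P.root) C :=
      ⟨b1, b2, Fin.strictMono_iff_lt_succ.mpr b4, b3, b5⟩
    have hr := hmax _ C hC (by
      rw [h3, b7]
      refine insert_subset_insert fun S hS ↦ ?_
      simp only [List.map_append, List.map_cons, List.mem_append, List.mem_cons,
        mem_ofPred_eq] at hS ⊢
      tauto)
    have := hcard _ B hB
    rw [← hr, hcard _ C hC] at this
    simp at this hkL
    omega
  · rintro ⟨h, hl⟩
    obtain ⟨k, B, hB, rfl⟩ := exists_isAdmissibleChain_iff.mpr h
    have hk : k = 2 * finrank ℝ V := by simpa [signature] using hl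
    refine ⟨k, B, ⟨hB, fun m C hC hsub ↦ ?_⟩, rfl⟩
    refine (Set.eq_of_subset_of_ncard_le hsub ?_ (finite_range C)).symm
    rw [hcard _ B hB, hcard _ C hC, hk]
    exact Nat.succ_le_succ (hle _ C hC)

end ChainLength

/-! ### Sweeping through a subcritical graph -/

section Caterpillar

variable {J : Type*} [Fintype J] [DecidableEq J] {G : SimpleGraph J} [DecidableRel G.Adj]

variable (G) in
/-- No nonzero nonnegative vertex weighting is dominated, on its support, by half of the sum over the
neighbours. This is the shape in which positive definiteness of a root system is used. -/
def SimpleGraph.IsSubcritical : Prop :=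
  ∀ c : J → ℕ, c ≠ 0 → ∃ i, c i ≠ 0 ∧ ∑ j, (if G.Adj i j then c j else 0) < 2 * c i

lemma sum_adj_single (i v : J) (k : ℕ) :
    ∑ j, (if G.Adj i j then Pi.single (M := fun _ ↦ ℕ) v k j else 0) =
      if G.Adj i v then k else 0 := by
  rw [Finset.sum_eq_single v]
  · simp
  · intro j _ hj
    simp [hj]
  · simp

omit [DecidableEq J] in
lemma sum_adj_add (i : J) (c d : J → ℕ) :
    ∑ j, (if G.Adj i j then (c + d) j else 0) =
      ∑ j, (if G.Adj i j then c j else 0) + ∑ j, (if G.Adj i j then d j else 0) := by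
  rw [← Finset.sum_add_distrib]
  exact Finset.sum_congr rfl fun j _ ↦ by split_ifs <;> simp

lemma SimpleGraph.IsSubcritical.no_triangle (hG : G.IsSubcritical) {a b c : J}
    (hab : G.Adj a b) (hbc : G.Adj b c) (hac : G.Adj a c) : False := by
  obtain ⟨i, hi, hlt⟩ := hG (Pi.single a 1 + Pi.single b 1 + Pi.single c 1) fun h ↦ by
    simpa [hab.ne, hac.ne] using congrFun h a
  simp only [sum_adj_add, sum_adj_single] at hlt
  have : i = a ∨ i = b ∨ i = c := by
    by_contra! h
    simp [h] at hi
  rcases this with rfl | rfl | rfl <;>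
  simp [hab, hbc, hac, hab.symm, hbc.symm, hac.symm, hab.ne, hbc.ne, hac.ne, hab.ne', hbc.ne',
    hac.ne'] at hlt

lemma SimpleGraph.IsSubcritical.no_square (hG : G.IsSubcritical) {a b c d : J}
    (hab : G.Adj a b) (hbc : G.Adj b c) (hcd : G.Adj c d) (hda : G.Adj d a)
    (hac : a ≠ c) (hbd : b ≠ d) : False := by
  obtain ⟨i, hi, hlt⟩ := hG (Pi.single a 1 + Pi.single b 1 + Pi.single c 1 + Pi.single d 1)
    fun h ↦ by simpa [hab.ne, hac, hda.ne'] using congrFun h a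
  simp only [sum_adj_add, sum_adj_single] at hlt
  have : i = a ∨ i = b ∨ i = c ∨ i = d := by
    by_contra! h
    simp [h] at hi
  rcases this with rfl | rfl | rfl | rfl <;>
  simp [hab, hbc, hcd, hda, hab.symm, hbc.symm, hcd.symm, hda.symm, hab.ne, hbc.ne, hcd.ne, hda.ne,
    hab.ne', hbc.ne', hcd.ne', hda.ne', hac, hbd, hac.symm, hbd.symm] at hlt
  omega

/-- The graph contains no tree with three legs of length two. -/
lemma SimpleGraph.IsSubcritical.no_spider (hG : G.IsSubcritical) {y u v w u' v' w' : J}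
    (hu : G.Adj y u) (hv : G.Adj y v) (hw : G.Adj y w) (huv : u ≠ v) (huw : u ≠ w) (hvw : v ≠ w)
    (hu' : G.Adj u u') (hv' : G.Adj v v') (hw' : G.Adj w w')
    (hyu : u' ≠ y) (hyv : v' ≠ y) (hyw : w' ≠ y) : False := by
  have tri : ∀ {p q p'}, G.Adj y p → G.Adj y q → G.Adj p p' → p' ≠ q := by
    rintro p q _ hp hq hpp' rfl
    exact hG.no_triangle hp hpp' hq
  have sq : ∀ {p q p' q'}, G.Adj y p → G.Adj y q → G.Adj p p' → G.Adj q q' → p ≠ q → p' ≠ y →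
      p' ≠ q' := by
    rintro p q p' _ hp hq hpp' hqq' hpq hy rfl
    exact hG.no_square hp hpp' hqq'.symm hq.symm hy.symm hpq
  have d1 := tri hu hv hu'
  have d2 := tri hu hw hu'
  have d3 := tri hv hu hv'
  have d4 := tri hv hw hv'
  have d5 := tri hw hu hw'
  have d6 := tri hw hv hw'
  have d7 := sq hu hv hu' hv' huv hyu
  have d8 := sq hu hw hu' hw' huw hyu
  have d9 := sq hv hw hv' hw' hvw hyv
  -- These are the marks of the affine diagram of type `E₆`: at each vertex the neighbours sum to
  -- twice the weight.
  obtain ⟨i, hi, hlt⟩ := hG (Pi.single y 3 + Pi.single u 2 + Pi.single v 2 + Pi.single w 2 +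
    Pi.single u' 1 + Pi.single v' 1 + Pi.single w' 1)
    fun h ↦ by simpa [hu.ne, hv.ne, hw.ne, hyu.symm, hyv.symm, hyw.symm] using congrFun h y
  simp only [sum_adj_add, sum_adj_single] at hlt
  have : i = y ∨ i = u ∨ i = v ∨ i = w ∨ i = u' ∨ i = v' ∨ i = w' := by
    by_contra! h
    simp [h] at hi
  rcases this with rfl | rfl | rfl | rfl | rfl | rfl | rfl <;>
  simp [hu, hv, hw, hu', hv', hw', hu.symm, hv.symm, hw.symm, hu'.symm, hv'.symm, hw'.symm,
    hu.ne, hv.ne, hw.ne, hu'.ne, hv'.ne, hw'.ne, hu.ne', hv.ne', hw.ne', hu'.ne', hv'.ne', hw'.ne',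
    huv, huw, hvw, huv.symm, huw.symm, hvw.symm, hyu, hyv, hyw, hyu.symm, hyv.symm, hyw.symm,
    d1, d2, d3, d4, d5, d6, d7, d8, d9, d1.symm, d2.symm, d3.symm, d4.symm, d5.symm, d6.symm,
    d7.symm, d8.symm, d9.symm] at hlt <;> omega

variable (G) in
/-- The vertex `v` has at least two neighbours. -/
def SimpleGraph.IsInner (v : J) : Prop := ∃ a b, a ≠ b ∧ G.Adj v a ∧ G.Adj v b

omit [Fintype J] [DecidableRel G.Adj] in
lemma SimpleGraph.IsInner.exists_adj_ne {v : J} (h : G.IsInner v) (y : J) :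
    ∃ v', G.Adj v v' ∧ v' ≠ y := by
  obtain ⟨a, b, hab, ha, hb⟩ := h
  by_cases hy : a = y
  · exact ⟨b, hb, fun h ↦ hab (hy.trans h.symm)⟩
  · exact ⟨a, ha, hy⟩

variable (G) in
/-- A state of the sweep through a caterpillar: `S` is the set of finished vertices and `x` is the
current one. -/
structure SimpleGraph.IsSweep (S : Finset J) (x : J) : Prop where
  notMem : x ∉ S
  not_adj : ∀ s ∈ S, ∀ t ∉ S, t ≠ x → ¬ G.Adj s t
  eq_of_isInner : ∀ u ∉ S, ∀ v ∉ S, G.Adj x u → G.Adj x v → G.IsInner u → G.IsInner v → u = v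
  isInner : G.IsInner x ∨ ∀ u ∉ S, G.Adj x u → ¬ G.IsInner u

lemma SimpleGraph.IsSubcritical.exists_isSweep [Nonempty J] (hG : G.IsSubcritical) :
    ∃ x, G.IsSweep ∅ x := by
  classical
  by_cases h : ∃ v, G.IsInner v
  · obtain ⟨v, hv⟩ := h
    -- Weighting the inner vertices by `1` yields an inner vertex with at most one inner neighbour:
    -- an end of the spine.
    obtain ⟨x, hx, hlt⟩ := hG (fun v ↦ if G.IsInner v then 1 else 0) fun h ↦ by
      simpa [hv] using congrFun h v
    have hx : G.IsInner x := by simpa using hx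
    refine ⟨x, by simp, by simp, fun u _ v _ hu hv hu' hv' ↦ ?_, Or.inl hx⟩
    by_contra huv
    simp only [hx, if_true] at hlt
    rw [← Finset.sum_erase_add _ _ (Finset.mem_univ u),
      ← Finset.sum_erase_add _ _ (Finset.mem_erase.mpr ⟨Ne.symm huv, Finset.mem_univ v⟩)] at hlt
    simp [hu, hv, hu', hv'] at hlt
  · push Not at h
    exact ⟨Classical.arbitrary J, by simp, by simp, fun u _ _ _ _ _ hu ↦ absurd hu (h u),
      Or.inr fun u _ _ ↦ h u⟩

/-- If `x` has an unfinished neighbour that is a leaf, finish that leaf. Otherwise finish `x` and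
move to its only unfinished neighbour, the next vertex `u` of the spine. Two further inner
neighbours of `u` would form, with `x`, the spider excluded above. -/
lemma SimpleGraph.IsSweep.exists_next (hG : G.IsSubcritical)
    (hconn : ∀ T : Finset J, T.Nonempty → (∀ s ∈ T, ∀ t, G.Adj s t → t ∈ T) → T = Finset.univ)
    {S : Finset J} {x : J} (h : G.IsSweep S x) (hne : insert x S ≠ Finset.univ) :
    ∃ S' x', G.IsSweep S' x' ∧ S ⊂ S' ∧ S'.card = S.card + 1 ∧ insert x S ⊂ insert x' S' := by
  obtain ⟨u, huS, hux⟩ : ∃ u ∉ S, G.Adj x u := by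
    by_contra! hno
    refine hne (hconn _ ⟨x, by simp⟩ fun s hs t hst ↦ ?_)
    by_contra ht
    simp only [Finset.mem_insert, not_or] at hs ht
    rcases hs with rfl | hs
    · exact hno t ht.2 hst
    · exact h.not_adj s hs t ht.2 ht.1 hst
  by_cases hleaf : ∃ u ∉ S, G.Adj x u ∧ ¬ G.IsInner u
  · obtain ⟨u, huS, hux, hu⟩ := hleaf
    refine ⟨insert u S, x, ⟨?_, ?_, ?_, ?_⟩, Finset.ssubset_insert huS,
      Finset.card_insert_of_notMem huS, ?_⟩
    · simp [hux.ne, h.notMem]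
    · intro s hs t ht htx hst
      simp only [Finset.mem_insert, not_or] at hs ht
      rcases hs with rfl | hs
      · exact hu ⟨x, t, htx.symm, hux.symm, hst⟩
      · exact h.not_adj s hs t ht.2 htx hst
    · intro v hv w hw
      simp only [Finset.mem_insert, not_or] at hv hw
      exact h.eq_of_isInner v hv.2 w hw.2
    · refine h.isInner.imp_right fun h' v hv ↦ h' v fun hvS ↦ hv (Finset.mem_insert_of_mem hvS)
    · rw [Finset.insert_comm]
      exact Finset.ssubset_insert (by simp [hux.ne', huS])
  · push Not at hleaf
    have hxi : G.IsInner x := h.isInner.resolve_right fun h' ↦ h' u huS hux (hleaf u huS hux)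
    have huS' : u ∉ insert x S := by simp [hux.ne', huS]
    refine ⟨insert x S, u, ⟨huS', ?_, ?_, Or.inl (hleaf u huS hux)⟩, Finset.ssubset_insert h.notMem,
      Finset.card_insert_of_notMem h.notMem, Finset.ssubset_insert huS'⟩
    · intro s hs t ht htu hst
      simp only [Finset.mem_insert, not_or] at hs ht
      rcases hs with rfl | hs
      · exact htu (h.eq_of_isInner t ht.2 u huS hst hux (hleaf t ht.2 hst) (hleaf u huS hux))
      · exact h.not_adj s hs t ht.2 ht.1 hst
    · intro v hv w hw huv huw hvi hwi
      simp only [Finset.mem_insert, not_or] at hv hw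
      by_contra hvw
      obtain ⟨x', hx', hxu⟩ := hxi.exists_adj_ne u
      obtain ⟨v', hv', hvu⟩ := hvi.exists_adj_ne u
      obtain ⟨w', hw', hwu⟩ := hwi.exists_adj_ne u
      exact hG.no_spider hux.symm huv huw (Ne.symm hv.1) (Ne.symm hw.1) hvw hx' hv' hw' hxu hvu hwu

/-- A connected subcritical graph can be swept: the vertices are removed one by one, and put back
one by one, in such a way that the first `p` vertices which are put back are not adjacent to those
which are left after the removal of `p + 1` vertices. -/
theorem SimpleGraph.IsSubcritical.exists_sweep [Nonempty J] (hG : G.IsSubcritical)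
    (hconn : ∀ T : Finset J, T.Nonempty → (∀ s ∈ T, ∀ t, G.Adj s t → t ∈ T) → T = Finset.univ) :
    ∃ R A : ℕ → Finset J, R 0 = ∅ ∧ A 0 = ∅ ∧
      R (Fintype.card J) = Finset.univ ∧ A (Fintype.card J) = Finset.univ ∧
      (∀ p < Fintype.card J, R p ⊂ R (p + 1)) ∧ (∀ p < Fintype.card J, A p ⊂ A (p + 1)) ∧
      ∀ p < Fintype.card J, ∀ s ∈ A p, ∀ t ∉ R (p + 1), s ≠ t ∧ ¬ G.Adj s t := by
  set n := Fintype.card J with hn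
  obtain ⟨x₀, h₀⟩ := hG.exists_isSweep
  have hstep : ∀ σ : {σ : Finset J × J // G.IsSweep σ.1 σ.2},
      ∃ τ : {σ : Finset J × J // G.IsSweep σ.1 σ.2}, insert σ.1.2 σ.1.1 ≠ Finset.univ →
        σ.1.1 ⊂ τ.1.1 ∧ τ.1.1.card = σ.1.1.card + 1 ∧ insert σ.1.2 σ.1.1 ⊂ insert τ.1.2 τ.1.1 := by
    rintro ⟨⟨S, x⟩, h⟩
    by_cases hne : insert x S = Finset.univ
    · exact ⟨⟨⟨S, x⟩, h⟩, fun h' ↦ absurd hne h'⟩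
    · obtain ⟨S', x', h', hS⟩ := h.exists_next hG hconn hne
      exact ⟨⟨⟨S', x'⟩, h'⟩, fun _ ↦ hS⟩
  choose next hnext using hstep
  let st : ℕ → {σ : Finset J × J // G.IsSweep σ.1 σ.2} := fun p ↦ next^[p] ⟨⟨∅, x₀⟩, h₀⟩
  have hsucc : ∀ p, st (p + 1) = next (st p) := fun p ↦ Function.iterate_succ_apply' ..
  have hins : ∀ p, (insert (st p).1.2 (st p).1.1).card = (st p).1.1.card + 1 :=
    fun p ↦ Finset.card_insert_of_notMem (st p).2.notMem
  have hcard : ∀ p < n, (st p).1.1.card = p := by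
    intro p
    induction p with
    | zero => intro _; rfl
    | succ p ih =>
      intro hp
      have := ih (by omega)
      rw [hsucc, (hnext (st p) ?_).2.1, this]
      intro he
      have h1 := hins p
      rw [he, Finset.card_univ] at h1
      omega
  have hne : ∀ p, p + 1 < n → insert (st p).1.2 (st p).1.1 ≠ Finset.univ := by
    intro p hp he
    have h1 := hins p
    rw [he, Finset.card_univ, hcard p (by omega)] at h1
    omega
  have hpos : 0 < n := Fintype.card_pos
  -- With `S_p` and `x_p` the state at time `p`, take `A p = S_p` and `R (p + 1) = S_p ∪ {x_p}`, so
  -- `R` is one vertex ahead. The sweep ends with `n - 1` finished vertices, hence the separate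
  -- value of `A` at `n`.
  refine ⟨fun p ↦ p.casesOn ∅ fun p ↦ insert (st p).1.2 (st p).1.1,
    fun p ↦ if p < n then (st p).1.1 else Finset.univ, rfl, by simp [hpos, st], ?_, by simp, ?_, ?_,
    ?_⟩
  · obtain ⟨m, hm⟩ : ∃ m, n = m + 1 := Nat.exists_eq_succ_of_ne_zero hpos.ne'
    rw [hm]
    refine Finset.eq_univ_of_card _ ?_
    change (insert (st m).1.2 (st m).1.1).card = _
    rw [hins, hcard m (by omega), ← hn, hm]
  · rintro (_ | p) hp
    · exact ⟨Finset.empty_subset _, fun h ↦ by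
        simpa using h (Finset.mem_insert_self (st 0).1.2 (st 0).1.1)⟩
    · change insert (st p).1.2 (st p).1.1 ⊂ insert (st (p + 1)).1.2 (st (p + 1)).1.1
      rw [hsucc]
      exact (hnext (st p) (hne p hp)).2.2
  · intro p hp
    simp only [hp, if_true]
    by_cases hp' : p + 1 < n
    · simp only [hp', if_true]
      rw [hsucc]
      exact (hnext (st p) (hne p hp')).1
    · simp only [hp', if_false]
      exact ⟨Finset.subset_univ _, fun h ↦ (st p).2.notMem (h (Finset.mem_univ _))⟩
  · intro p hp s hs t ht
    simp only [hp, if_true] at hs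
    simp only [Finset.mem_insert, not_or] at ht
    exact ⟨fun h ↦ ht.2 (h ▸ hs), (st p).2.not_adj s hs t ht.2 ht.1⟩

end Caterpillar

/-! ### Dynkin graphs and supports of roots -/

namespace RootPairing.Base

open Module Set

variable {ι V V' : Type*} [AddCommGroup V] [Module ℝ V] [AddCommGroup V'] [Module ℝ V']
  {P : RootPairing ι ℝ V V'}

/-- The underlying graph of the Dynkin diagram. -/
def dynkinGraph (b : P.Base) : SimpleGraph b.support where
  Adj i j := i ≠ j ∧ P.pairing i j ≠ 0
  symm := ⟨fun _ _ h ↦ ⟨h.1.symm, fun h0 ↦ h.2 (P.pairing_eq_zero_iff'.mp h0)⟩⟩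
  loopless := ⟨fun _ h ↦ h.1 rfl⟩

lemma pairing_eq_zero_of_not_adj {b : P.Base} {i j : b.support} (hij : i ≠ j)
    (h : ¬ b.dynkinGraph.Adj i j) : P.pairing i j = 0 := by
  by_contra h0
  exact h ⟨hij, h0⟩

variable [Finite ι] [P.IsCrystallographic]

/-- The two pairings of adjacent simple roots are negative integers, so their product is at least
`1`. -/
lemma rootForm_mul_rootForm_le_of_adj [Fintype ι] {b : P.Base} {i j : b.support}
    (h : b.dynkinGraph.Adj i j) :
    P.RootForm (P.root i) (P.root i) * P.RootForm (P.root j) (P.root j) ≤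
      4 * P.RootForm (P.root i) (P.root j) ^ 2 := by
  have e1 := P.toInvariantForm.two_mul_apply_root_root i j
  have e2 := P.toInvariantForm.two_mul_apply_root_root j i
  simp only [toInvariantForm_form] at e1 e2
  have hs : P.RootForm (P.root j) (P.root i) = P.RootForm (P.root i) (P.root j) :=
    (P.rootForm_symmetric.eq _ _).symm
  rw [hs] at e2
  have hne : P.pairing i j ≠ 0 := h.2
  have hne' : P.pairing j i ≠ 0 := fun h0 ↦ hne (P.pairing_eq_zero_iff'.mp h0)
  have hij : (i : ι) ≠ j := fun h' ↦ h.1 (Subtype.ext h')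
  have l1 := b.pairingIn_le_zero_of_ne hij i.2 j.2
  have l2 := b.pairingIn_le_zero_of_ne hij.symm j.2 i.2
  rw [← P.algebraMap_pairingIn ℤ] at hne hne' e1 e2
  simp only [algebraMap_int_eq, eq_intCast, ne_eq, Int.cast_eq_zero] at hne hne' e1 e2
  have m1 : 1 ≤ P.pairingIn ℤ i j * P.pairingIn ℤ j i := by
    have : P.pairingIn ℤ i j ≤ -1 := by omega
    have : P.pairingIn ℤ j i ≤ -1 := by omega
    nlinarith
  have m2 : (1 : ℝ) ≤ (P.pairingIn ℤ i j : ℝ) * P.pairingIn ℤ j i := by exact_mod_cast m1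
  have q1 := P.zero_le_rootForm (P.root i)
  have q2 := P.zero_le_rootForm (P.root j)
  have : 4 * P.RootForm (P.root i) (P.root j) ^ 2 =
      ((P.pairingIn ℤ i j : ℝ) * P.pairingIn ℤ j i) *
        (P.RootForm (P.root i) (P.root i) * P.RootForm (P.root j) (P.root j)) := by
    calc _ = (2 * P.RootForm (P.root i) (P.root j)) * (2 * P.RootForm (P.root i) (P.root j)) := by
          ring
      _ = _ := by
          nth_rw 1 [e1]
          rw [e2]
          ring
  rw [this]
  nlinarith [mul_nonneg q1 q2]

variable [P.IsRootSystem]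

-- Simple roots scaled to norm one have inner product at most `-1/2` along edges and `0` between
-- distinct non-adjacent vertices. A weighting violating the condition would give a nonzero vector
-- of nonpositive square length.
open Classical in
lemma isSubcritical_dynkinGraph (b : P.Base) : b.dynkinGraph.IsSubcritical := by
  have _i : Fintype ι := Fintype.ofFinite ι
  intro c hc
  by_contra! hle
  let q : b.support → ℝ := fun i ↦ √(P.RootForm (P.root i) (P.root i))
  have hq2 : ∀ i : b.support, q i * q i = P.RootForm (P.root i) (P.root i) :=
    fun i ↦ Real.mul_self_sqrt (P.zero_le_rootForm _)
  have hq : ∀ i, 0 < q i := fun i ↦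
    Real.sqrt_pos.mpr (P.rootForm_pos_of_ne_zero (by simp) (P.ne_zero i))
  let g : b.support → b.support → ℝ := fun i j ↦
    P.RootForm (P.root i) (P.root j) / (q i * q j)
  have hgs : ∀ i, g i i = 1 := fun i ↦ by
    simp only [g]
    rw [hq2, div_self]
    rw [← hq2]
    exact (mul_pos (hq i) (hq i)).ne'
  have hgn : ∀ i j, i ≠ j → ¬ b.dynkinGraph.Adj i j → g i j = 0 := by
    intro i j hij h
    simp only [g]
    have h0 := (P.toInvariantForm.apply_root_root_zero_iff i j).mpr
      (pairing_eq_zero_of_not_adj hij h)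
    simp only [toInvariantForm_form] at h0
    rw [h0, zero_div]
  have hga : ∀ i j, b.dynkinGraph.Adj i j → g i j ≤ -(1 / 2) := by
    intro i j h
    have hpos := mul_pos (hq i) (hq j)
    rw [div_le_iff₀ hpos]
    have h1 := rootForm_mul_rootForm_le_of_adj h
    rw [← hq2, ← hq2] at h1
    have h2 : P.RootForm (P.root i) (P.root j) ≤ 0 := by
      have hij : (i : ι) ≠ j := fun h' ↦ h.1 (Subtype.ext h')
      have l1 := b.pairingIn_le_zero_of_ne hij i.2 j.2
      have e1 := P.toInvariantForm.two_mul_apply_root_root i j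
      simp only [toInvariantForm_form] at e1
      rw [← P.algebraMap_pairingIn ℤ] at e1
      simp only [algebraMap_int_eq, eq_intCast] at e1
      have l1' : (P.pairingIn ℤ i j : ℝ) ≤ 0 := by exact_mod_cast l1
      have := P.zero_le_rootForm (P.root j)
      nlinarith
    have h3 : (q i * q j) ^ 2 ≤ (-2 * P.RootForm (P.root i) (P.root j)) ^ 2 := by nlinarith
    have := abs_le_of_sq_le_sq h3 (by linarith)
    linarith [this, le_abs_self (q i * q j)]
  have hrow : ∀ i, (c i : ℝ) * ∑ j, (c j : ℝ) * g i j ≤ 0 := by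
    intro i
    by_cases hi : c i = 0
    · simp [hi]
    refine mul_nonpos_of_nonneg_of_nonpos (by positivity) ?_
    have h1 : ∀ j, (c j : ℝ) * g i j ≤
        (if i = j then (c j : ℝ) else 0) - 1 / 2 * (if b.dynkinGraph.Adj i j then c j else 0) := by
      intro j
      have hcj : (0 : ℝ) ≤ c j := by positivity
      by_cases hij : i = j
      · subst hij
        simp [hgs]
      · by_cases ha : b.dynkinGraph.Adj i j
        · simp only [hij, ha, if_false, if_true]
          nlinarith [hga i j ha]
        · simp [hij, ha, hgn i j hij ha]
    refine (Finset.sum_le_sum fun j _ ↦ h1 j).trans ?_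
    rw [Finset.sum_sub_distrib, ← Finset.mul_sum]
    have h2 := hle i hi
    have h3 : (2 * c i : ℝ) ≤ ∑ j, (if b.dynkinGraph.Adj i j then (c j : ℝ) else 0) := by
      exact_mod_cast h2
    simp only [Finset.sum_ite_eq, Finset.mem_univ, if_true]
    push_cast
    linarith
  let v : V := ∑ i, ((c i : ℝ) / q i) • P.root i
  have hv : P.RootForm v v = ∑ i, (c i : ℝ) * ∑ j, (c j : ℝ) * g i j := by
    simp only [v, map_sum, map_smul, LinearMap.sum_apply, LinearMap.smul_apply, smul_eq_mul,
      Finset.mul_sum, g]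
    rw [Finset.sum_comm]
    refine Finset.sum_congr rfl fun i _ ↦ Finset.sum_congr rfl fun j _ ↦ ?_
    have := (hq i).ne'
    have := (hq j).ne'
    field_simp
  have hv0 : v = 0 := by
    by_contra hne
    have := P.rootForm_pos_of_ne_zero (x := v) (by simp) hne
    rw [hv] at this
    exact this.not_ge (Finset.sum_nonpos fun i _ ↦ hrow i)
  refine hc (funext fun i ↦ ?_)
  have hlin := Fintype.linearIndependent_iff.mp b.toWeightBasis.linearIndependent
    (fun i ↦ (c i : ℝ) / q i) (by simp only [b.toWeightBasis_apply]; exact hv0) i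
  have := (hq i).ne'
  simpa [this] using hlin

/-! ### Coordinates of roots -/

omit [Finite ι] [P.IsCrystallographic]

lemma repr_nonneg_of_mem_closure (b : P.Base) {x : V}
    (hx : x ∈ AddSubmonoid.closure (P.root '' b.support)) (i : b.support) :
    0 ≤ b.toWeightBasis.repr x i := by
  classical
  induction hx using AddSubmonoid.closure_induction with
  | mem x hx =>
    obtain ⟨j, hj, rfl⟩ := hx
    rw [show P.root j = P.root (⟨j, hj⟩ : b.support) from rfl, b.toWeightBasis_repr_root,
      Finsupp.single_apply]
    split_ifs <;> simp
  | zero => simp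
  | add x y _ _ hx hy => simpa using add_nonneg hx hy

lemma repr_nonneg_or_nonpos (b : P.Base) {x : V} (hx : x ∈ range P.root) :
    (∀ i, 0 ≤ b.toWeightBasis.repr x i) ∨ (∀ i, b.toWeightBasis.repr x i ≤ 0) := by
  obtain ⟨k, rfl⟩ := hx
  refine (b.root_mem_or_neg_mem k).imp (fun h i ↦ b.repr_nonneg_of_mem_closure h i) fun h i ↦ ?_
  simpa using b.repr_nonneg_of_mem_closure h i

lemma exists_repr_ne_zero (b : P.Base) {x : V} (hx : x ∈ range P.root) :
    ∃ i, b.toWeightBasis.repr x i ≠ 0 := by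
  obtain ⟨k, rfl⟩ := hx
  by_contra! h
  refine P.ne_zero k (b.toWeightBasis.repr.injective ?_)
  ext i
  simp [h i]

/-- The support of a root is connected: if it is covered by two mutually orthogonal sets of simple
roots then it is contained in one of them. -/
lemma repr_eq_zero_or_of_not_adj [Finite ι] [P.IsCrystallographic] (b : P.Base)
    {D E : Set b.support} (h : ∀ s ∈ D, ∀ t ∈ E, s ≠ t ∧ ¬ b.dynkinGraph.Adj s t)
    {x : V} (hx : x ∈ range P.root) (hDE : ∀ i, i ∉ D → i ∉ E → b.toWeightBasis.repr x i = 0) :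
    (∀ i ∉ D, b.toWeightBasis.repr x i = 0) ∨ (∀ i ∉ E, b.toWeightBasis.repr x i = 0) := by
  classical
  obtain ⟨k, rfl⟩ := hx
  wlog hk : b.IsPos k generalizing k
  · have hneg : b.IsPos (P.reflectionPerm k k) := (IsPos.or_neg b k).resolve_left hk
    have := this (P.reflectionPerm k k) (by simpa using hDE) hneg
    simpa using this
  -- Nonnegativity of the coordinates is carried through the induction so that adding a simple root
  -- never cancels a coordinate.
  let p : ι → Prop := fun k ↦ (∀ i, 0 ≤ b.toWeightBasis.repr (P.root k) i) ∧
      ((∀ i, i ∉ D → i ∉ E → b.toWeightBasis.repr (P.root k) i = 0) →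
        (∀ i ∉ D, b.toWeightBasis.repr (P.root k) i = 0) ∨
        (∀ i ∉ E, b.toWeightBasis.repr (P.root k) i = 0))
  suffices key : p k from key.2 hDE
  have hsimple : ∀ (j : b.support) (i : b.support),
      b.toWeightBasis.repr (P.root j) i = if j = i then 1 else 0 := by
    intro j i
    rw [b.toWeightBasis_repr_root, Finsupp.single_apply]
  have horth : ∀ (m : ι) (j : b.support) (F : Set b.support),
      (∀ i ∉ F, b.toWeightBasis.repr (P.root m) i = 0) →
      (∀ s ∈ F, s ≠ j ∧ ¬ b.dynkinGraph.Adj s j) → P.pairing m j = 0 := by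
    intro m j F hF hFj
    rw [← P.root_coroot'_eq_pairing, ← b.toWeightBasis.sum_repr (P.root m), map_sum]
    refine Finset.sum_eq_zero fun i _ ↦ ?_
    by_cases hi : i ∈ F
    · rw [map_smul, b.toWeightBasis_apply, P.root_coroot'_eq_pairing,
        pairing_eq_zero_of_not_adj (hFj i hi).1 (hFj i hi).2, smul_zero]
    · rw [hF i hi, zero_smul, map_zero]
  clear hDE
  refine hk.induction_on_add (p := p) (fun j hj ↦ ⟨fun i ↦ ?_, fun hc ↦ ?_⟩) ?_
  · exact b.repr_nonneg_of_mem_closure (AddSubmonoid.subset_closure ⟨j, hj, rfl⟩) i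
  · have hs := hsimple ⟨j, hj⟩
    simp only at hs
    by_cases hD : (⟨j, hj⟩ : b.support) ∈ D
    · left
      intro i hi
      rw [hs, if_neg]
      rintro rfl
      exact hi hD
    · right
      intro i hi
      rw [hs, if_neg]
      rintro rfl
      have := hc _ hD hi
      rw [hs] at this
      simp at this
  · rintro i j k hadd ⟨hi0, hi⟩ hj
    obtain ⟨j, rfl⟩ : ∃ j' : b.support, j = j' := ⟨⟨j, hj⟩, rfl⟩
    have hr : ∀ l, b.toWeightBasis.repr (P.root k) l =
        b.toWeightBasis.repr (P.root i) l + if j = l then 1 else 0 := by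
      intro l
      rw [hadd, map_add, Finsupp.add_apply, hsimple]
    have hnn : ∀ l, (0 : ℝ) ≤ if j = l then 1 else 0 := fun l ↦ by split_ifs <;> simp
    refine ⟨fun l ↦ by rw [hr]; exact add_nonneg (hi0 l) (hnn l), fun hc ↦ ?_⟩
    have hzero : ∀ l, b.toWeightBasis.repr (P.root k) l = 0 →
        b.toWeightBasis.repr (P.root i) l = 0 ∧ j ≠ l := by
      intro l hl
      rw [hr] at hl
      have h1 := hi0 l
      have h2 := hnn l
      refine ⟨by linarith, fun hjl ↦ ?_⟩
      rw [if_pos hjl] at hl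
      linarith
    have hmix : ∀ F : Set b.support, (∀ l ∉ F, b.toWeightBasis.repr (P.root i) l = 0) →
        (∀ s ∈ F, s ≠ j ∧ ¬ b.dynkinGraph.Adj s j) → False := by
      intro F hF hFj
      have h0 := horth i j F hF hFj
      -- If root `i` and the simple root `j` are orthogonal, reflecting their sum in `j` gives their
      -- difference, a root with coordinates of both signs.
      have hsub : P.root (P.reflectionPerm j k) = P.root i - P.root j := by
        rw [P.root_reflectionPerm, hadd, map_add, P.reflection_apply_root, h0,
          P.reflection_apply_self]
        module
      have hs : ∀ l, b.toWeightBasis.repr (P.root (P.reflectionPerm j k)) l =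
          b.toWeightBasis.repr (P.root i) l - if j = l then 1 else 0 := by
        intro l
        rw [hsub, map_sub, Finsupp.sub_apply, hsimple]
      have hjF : j ∉ F := fun hjF ↦ (hFj j hjF).1 rfl
      obtain ⟨m, hm⟩ := b.exists_repr_ne_zero (x := P.root i) ⟨i, rfl⟩
      have hmF : m ∈ F := by
        by_contra hmF
        exact hm (hF m hmF)
      have hmj : j ≠ m := fun h ↦ hjF (h ▸ hmF)
      have s1 := hs j
      rw [hF j hjF, if_pos rfl] at s1
      have s2 := hs m
      rw [if_neg hmj, sub_zero] at s2
      rcases b.repr_nonneg_or_nonpos (x := P.root (P.reflectionPerm j k)) ⟨_, rfl⟩ with hp | hp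
      · have := hp j
        rw [s1] at this
        linarith
      · have := hp m
        rw [s2] at this
        exact hm (le_antisymm this (hi0 m))
    have hjDE : j ∈ D ∨ j ∈ E := by
      by_contra! hj'
      exact (hzero j (hc j hj'.1 hj'.2)).2 rfl
    rcases hi fun l hl hl' ↦ (hzero l (hc l hl hl')).1 with hiD | hiE
    · rcases hjDE with hjD | hjE
      · left
        intro l hl
        rw [hr, hiD l hl, if_neg fun e : j = l ↦ hl (e ▸ hjD), add_zero]
      · exact (hmix D hiD fun s hs ↦ h s hs j hjE).elim
    · rcases hjDE with hjD | hjE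
      · exact (hmix E hiE fun s hs ↦ ⟨(h j hjD s hs).1.symm,
          fun ha ↦ (h j hjD s hs).2 ha.symm⟩).elim
      · right
        intro l hl
        rw [hr, hiE l hl, if_neg fun e : j = l ↦ hl (e ▸ hjE), add_zero]

end RootPairing.Base

/-! ### Biclosed sets from partial heights -/

namespace RootPairing.Base

open Module Set

variable {ι V V' : Type*} [AddCommGroup V] [Module ℝ V] [AddCommGroup V'] [Module ℝ V']
  {P : RootPairing ι ℝ V V'} [P.IsRootSystem]

open Classical in
/-- The sum of the coordinates indexed by `T`. -/
noncomputable def partialHeight (b : P.Base) (T : Finset b.support) : Dual ℝ V :=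
  ∑ i ∈ T, b.toWeightBasis.coord i

lemma partialHeight_apply (b : P.Base) (T : Finset b.support) (x : V) :
    b.partialHeight T x = ∑ i ∈ T, b.toWeightBasis.repr x i := by
  simp [partialHeight, LinearMap.sum_apply]

open Classical in
lemma partialHeight_root (b : P.Base) (T : Finset b.support) (j : b.support) :
    b.partialHeight T (P.root j) = if j ∈ T then 1 else 0 := by
  rw [partialHeight_apply]
  simp [b.toWeightBasis_repr_root, Finsupp.single_apply]

lemma partialHeight_eq_zero (b : P.Base) {T : Finset b.support} {x : V}
    (h : ∀ i ∈ T, b.toWeightBasis.repr x i = 0) : b.partialHeight T x = 0 := by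
  rw [partialHeight_apply]
  exact Finset.sum_eq_zero h

lemma repr_eq_zero_of_partialHeight (b : P.Base) {T : Finset b.support} {x : V}
    (hx : x ∈ range P.root) (h : b.partialHeight T x = 0) :
    ∀ i ∈ T, b.toWeightBasis.repr x i = 0 := by
  rw [partialHeight_apply] at h
  rcases b.repr_nonneg_or_nonpos hx with hp | hp
  · exact (Finset.sum_eq_zero_iff_of_nonneg fun i _ ↦ hp i).mp h
  · exact (Finset.sum_eq_zero_iff_of_nonpos fun i _ ↦ hp i).mp h

lemma repr_nonneg_of_partialHeight_pos (b : P.Base) {T : Finset b.support} {x : V}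
    (hx : x ∈ range P.root) (h : 0 < b.partialHeight T x) (i : b.support) :
    0 ≤ b.toWeightBasis.repr x i := by
  refine (b.repr_nonneg_or_nonpos hx).resolve_right (fun hp ↦ ?_) i
  rw [partialHeight_apply] at h
  exact h.not_ge (Finset.sum_nonpos fun i _ ↦ hp i)

lemma partialHeight_mono (b : P.Base) {T T' : Finset b.support} (hT : T ⊆ T') {x : V}
    (hx : ∀ i, 0 ≤ b.toWeightBasis.repr x i) : b.partialHeight T x ≤ b.partialHeight T' x := by
  rw [partialHeight_apply, partialHeight_apply]
  exact Finset.sum_le_sum_of_subset_of_nonneg hT fun i _ _ ↦ hx i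

open Classical in
/-- The biclosed set whose two-sided part is spanned by the simple roots in `A`, and for which the
two-sided part of the complement is spanned by the simple roots outside `R`. -/
def sweepSet (b : P.Base) (R A : Finset b.support) : Set V :=
  {x ∈ range P.root | 0 < b.partialHeight (R \ A) x ∨ ∀ i ∉ A, b.toWeightBasis.repr x i = 0}

/-- The simple roots in `A` are orthogonal to those outside `R`. -/
def Separated (b : P.Base) (R A : Finset b.support) : Prop :=
  ∀ s ∈ A, ∀ t ∉ R, s ≠ t ∧ ¬ b.dynkinGraph.Adj s t

variable {b : P.Base} {R R' A A' : Finset b.support}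

omit [P.IsRootSystem] in
lemma Separated.subset (h : b.Separated R A) : A ⊆ R := by
  intro s hs
  by_contra hR
  exact (h s hs s hR).1 rfl

open Classical in
lemma partialHeight_eq_zero_of_support (x : V) (h : ∀ i ∉ A, b.toWeightBasis.repr x i = 0) :
    b.partialHeight (R \ A) x = 0 :=
  b.partialHeight_eq_zero fun i hi ↦ h i (Finset.mem_sdiff.mp hi).2

open Classical in
lemma partialHeight_eq_zero_of_support' (x : V) (h : ∀ i ∈ R, b.toWeightBasis.repr x i = 0) :
    b.partialHeight (R \ A) x = 0 :=
  b.partialHeight_eq_zero fun i hi ↦ h i (Finset.mem_sdiff.mp hi).1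

variable [Finite ι] [P.IsCrystallographic]

open Classical in
lemma Separated.support_subset (h : b.Separated R A) {x : V} (hx : x ∈ range P.root)
    (h0 : b.partialHeight (R \ A) x = 0) :
    (∀ i ∉ A, b.toWeightBasis.repr x i = 0) ∨ (∀ i ∈ R, b.toWeightBasis.repr x i = 0) := by
  have := b.repr_eq_zero_or_of_not_adj (D := {i | i ∈ A}) (E := {i | i ∉ R}) h hx
    fun i hi hi' ↦ b.repr_eq_zero_of_partialHeight hx h0 i
      (Finset.mem_sdiff.mpr ⟨not_not.mp hi', hi⟩)
  simpa using this

omit [Finite ι] [P.IsCrystallographic] in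
lemma Separated.not_both (h : b.Separated R A) {x : V} (hx : x ∈ range P.root)
    (h1 : ∀ i ∉ A, b.toWeightBasis.repr x i = 0) (h2 : ∀ i ∈ R, b.toWeightBasis.repr x i = 0) :
    False := by
  obtain ⟨i, hi⟩ := b.exists_repr_ne_zero hx
  by_cases hA : i ∈ A
  · exact hi (h2 i (h.subset hA))
  · exact hi (h1 i hA)

-- The complement has the same shape as the set, with the sign of the height reversed and `R` in
-- place of the complement of `A`; its closedness is then proved in the same way.
open Classical in
lemma Separated.notMem_iff (h : b.Separated R A) {x : V} (hx : x ∈ range P.root) :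
    x ∉ b.sweepSet R A ↔
      b.partialHeight (R \ A) x < 0 ∨ ∀ i ∈ R, b.toWeightBasis.repr x i = 0 := by
  simp only [sweepSet, mem_ofPred_eq, hx, true_and, not_or, not_lt]
  constructor
  · rintro ⟨h1, h2⟩
    rcases h1.lt_or_eq with h1 | h1
    · exact Or.inl h1
    · exact Or.inr ((h.support_subset hx h1).resolve_left h2)
  · rintro (h1 | h1)
    · exact ⟨h1.le, fun h2 ↦ h1.ne (partialHeight_eq_zero_of_support x h2)⟩
    · exact ⟨(partialHeight_eq_zero_of_support' x h1).le, fun h2 ↦ h.not_both hx h2 h1⟩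

open Classical in
lemma Separated.isBiclosedIn (h : b.Separated R A) :
    IsBiclosedIn (range P.root) (b.sweepSet R A) := by
  refine ⟨fun x hx ↦ hx.1, ?_, ?_⟩
  · rintro x ⟨-, hx⟩ y ⟨-, hy⟩ a c ha hc hm
    refine ⟨hm, ?_⟩
    rw [map_add, map_smul, map_smul, smul_eq_mul, smul_eq_mul]
    rcases hx with hx | hx <;> rcases hy with hy | hy
    · left; positivity
    · left
      rw [partialHeight_eq_zero_of_support y hy, mul_zero, add_zero]
      positivity
    · left
      rw [partialHeight_eq_zero_of_support x hx, mul_zero, zero_add]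
      positivity
    · right
      intro i hi
      simp [hx i hi, hy i hi]
  · rintro x ⟨hxΦ, hx⟩ y ⟨hyΦ, hy⟩ a c ha hc hm
    refine ⟨hm, ?_⟩
    rw [h.notMem_iff hxΦ] at hx
    rw [h.notMem_iff hyΦ] at hy
    rw [h.notMem_iff hm, map_add, map_smul, map_smul, smul_eq_mul, smul_eq_mul]
    rcases hx with hx | hx <;> rcases hy with hy | hy
    · left; nlinarith
    · left
      rw [partialHeight_eq_zero_of_support' y hy, mul_zero, add_zero]
      nlinarith
    · left
      rw [partialHeight_eq_zero_of_support' x hx, mul_zero, zero_add]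
      nlinarith
    · right
      intro i hi
      simp [hx i hi, hy i hi]

omit [Finite ι] [P.IsCrystallographic] in
lemma Separated.sweepSet_step_zero (h : b.Separated R A) (hR : R ⊂ R') :
    b.sweepSet R A ⊂ b.sweepSet R' A ∧ StepRel 0 (b.sweepSet R A) (b.sweepSet R' A) := by
  classical
  refine ⟨⟨?_, fun hle ↦ ?_⟩, ?_⟩
  · rintro x ⟨hx, h1 | h1⟩
    · exact ⟨hx, Or.inl (h1.trans_le (b.partialHeight_mono (Finset.sdiff_subset_sdiff hR.1
        Finset.Subset.rfl) (b.repr_nonneg_of_partialHeight_pos hx h1)))⟩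
    · exact ⟨hx, Or.inr h1⟩
  · obtain ⟨t, ht, htR⟩ := Finset.exists_of_ssubset hR
    have htA : t ∉ A := fun hA ↦ htR (h.subset hA)
    obtain ⟨-, h1 | h1⟩ := hle (a := P.root t) ⟨⟨t, rfl⟩, Or.inl (by
      rw [partialHeight_root, if_pos (Finset.mem_sdiff.mpr ⟨ht, htA⟩)]; exact one_pos)⟩
    · rw [partialHeight_root, if_neg (fun h' ↦ htR (Finset.mem_sdiff.mp h').1)] at h1
      exact lt_irrefl _ h1
    · have := h1 t htA
      simp [b.toWeightBasis_repr_root] at this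
  · rw [stepRel_zero]
    rintro x ⟨hx, h1⟩ hx' ⟨-, h2⟩
    have h1 := h1.resolve_right fun h' ↦ hx' ⟨hx, Or.inr h'⟩
    rcases h2 with h2 | h2
    · rw [map_neg] at h2
      linarith
    · rw [← neg_neg x, map_neg, partialHeight_eq_zero_of_support _ h2, neg_zero] at h1
      exact lt_irrefl _ h1

lemma Separated.sweepSet_step_one (h : b.Separated R A') (hA : A ⊂ A') :
    b.sweepSet R A ⊂ b.sweepSet R A' ∧ StepRel 1 (b.sweepSet R A) (b.sweepSet R A') := by
  classical
  have hneg := P.neg_mem_range_root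
  have hs : b.Separated R A := fun s hs ↦ h s (hA.1 hs)
  refine ⟨⟨?_, fun hle ↦ ?_⟩, ?_⟩
  · rintro x ⟨hx, h1 | h1⟩
    · refine ⟨hx, ?_⟩
      have hx0 := b.repr_nonneg_of_partialHeight_pos hx h1
      -- The height may drop to zero when `A` grows. Connectedness of the support then puts the root
      -- in the span of `A'`, since it has a nonzero coordinate in `R`.
      have h2 : 0 ≤ b.partialHeight (R \ A') x := by
        rw [partialHeight_apply]
        exact Finset.sum_nonneg fun i _ ↦ hx0 i
      rcases h2.lt_or_eq with h2 | h2
      · exact Or.inl h2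
      · refine Or.inr ((h.support_subset hx h2.symm).resolve_right fun h3 ↦ ?_)
        rw [partialHeight_eq_zero_of_support' x h3] at h1
        exact lt_irrefl _ h1
    · exact ⟨hx, Or.inr fun i hi ↦ h1 i fun hi' ↦ hi (hA.1 hi')⟩
  · obtain ⟨t, ht, htA⟩ := Finset.exists_of_ssubset hA
    obtain ⟨-, h1 | h1⟩ := hle (a := -P.root t) ⟨hneg _ ⟨t, rfl⟩, Or.inr fun i hi ↦ by
      have hti : t ≠ i := fun e ↦ hi (e ▸ ht)
      rw [map_neg, b.toWeightBasis_repr_root, Finsupp.neg_apply, Finsupp.single_apply,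
        if_neg hti, neg_zero]⟩
    · rw [map_neg, partialHeight_root] at h1
      split_ifs at h1 <;> linarith
    · have := h1 t htA
      simp [b.toWeightBasis_repr_root] at this
  · rw [stepRel_one]
    rintro x ⟨hx, h1⟩ hx'
    rw [hs.notMem_iff hx] at hx'
    rcases hx' with h2 | h2
    · refine ⟨hneg x hx, Or.inl ?_⟩
      rw [map_neg]
      linarith
    · rcases h1 with h1 | h1
      · rw [partialHeight_eq_zero_of_support' x h2] at h1
        exact absurd h1 (lt_irrefl _)
      · exact (h.not_both hx h1 h2).elim

omit [Finite ι] [P.IsCrystallographic] in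
lemma sweepSet_empty (b : P.Base) : b.sweepSet ∅ ∅ = ∅ := by
  refine eq_empty_of_forall_notMem ?_
  rintro x ⟨hx, h | h⟩
  · rw [b.partialHeight_eq_zero (by simp)] at h
    exact lt_irrefl _ h
  · obtain ⟨i, hi⟩ := b.exists_repr_ne_zero hx
    exact hi (h i (by simp))

omit [Finite ι] [P.IsCrystallographic] in
lemma sweepSet_univ (b : P.Base) : b.sweepSet Finset.univ Finset.univ = range P.root :=
  Subset.antisymm (fun _ hx ↦ hx.1) fun _ hx ↦ ⟨hx, Or.inr (by simp)⟩

end RootPairing.Base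

/-! ### Realising a Dyck word and conclusion -/

open Module Set in
lemma IsExtendedDyckWord.hasWord {ι V V' : Type*} [Finite ι]
    [AddCommGroup V] [Module ℝ V] [AddCommGroup V'] [Module ℝ V']
    (P : RootPairing ι ℝ V V') [P.IsRootSystem] [P.IsCrystallographic] [P.IsReduced]
    [P.IsIrreducible] {w : List (Fin 2)} (hw : IsExtendedDyckWord (finrank ℝ V) w) :
    HasWord (range P.root) ∅ w (range P.root) := by
  classical
  obtain ⟨b⟩ := P.nonempty_base
  have hnt : Nontrivial V := RootPairing.IsIrreducible.nontrivial P
  have hne : Nonempty b.support := b.toWeightBasis.index_nonempty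
  have hcard : Fintype.card b.support = finrank ℝ V := (finrank_eq_card_basis b.toWeightBasis).symm
  obtain ⟨R, A, hR0, hA0, hRn, hAn, hR, hA, hsep⟩ :=
    b.isSubcritical_dynkinGraph.exists_sweep fun T ⟨i, hi⟩ hT ↦ by
      refine Finset.eq_univ_of_forall fun j ↦ ?_
      refine b.induction_on_cartanMatrix (· ∈ T) hi fun s t hs hst ↦ ?_
      by_cases he : s = t
      · exact he ▸ hs
      · refine hT s hs t ⟨he, fun h0 ↦ hst ?_⟩
        rw [RootPairing.Base.cartanMatrix_apply_eq_zero_iff_pairing]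
        exact P.pairing_eq_zero_iff'.mp h0
  rw [hcard] at hRn hAn hR hA hsep
  set n := finrank ℝ V with hn
  obtain ⟨hw0, hw1, hwlt⟩ := hw
  have hlen : w.length = 2 * n := by rw [← count_zero_add_count_one]; omega
  have hAmono : ∀ p q, p ≤ q → q ≤ n → A p ⊆ A q := by
    intro p q hpq
    induction q, hpq using Nat.le_induction with
    | base => exact fun _ ↦ Finset.Subset.rfl
    | succ q _ ih => exact fun hq ↦ (ih (by omega)).trans (hA q (by omega)).1
  have hcount0 : ∀ i, (w.take i).count 0 ≤ n :=
    fun i ↦ hw0 ▸ (List.take_sublist i w).count_le 0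
  have hcount1 : ∀ i, (w.take i).count 1 ≤ n :=
    fun i ↦ hw1 ▸ (List.take_sublist i w).count_le 1
  have hsep' : ∀ p q, q < p → p ≤ n → b.Separated (R p) (A q) := by
    intro p q hqp hp s hs t ht
    obtain ⟨p, rfl⟩ : ∃ k, p = k + 1 := Nat.exists_eq_succ_of_ne_zero (by omega)
    exact hsep p (by omega) s (hAmono q p (by omega) (by omega) hs) t ht
  -- The strict inequality fails at both ends of the word; there separation is vacuous, since `A` is
  -- empty or `R` is everything.
  have hstate : ∀ i ≤ 2 * n,
      b.Separated (R ((w.take i).count 0)) (A ((w.take i).count 1)) := by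
    intro i hi
    rcases Nat.eq_zero_or_pos i with rfl | hi0
    · intro s hs
      simp [hA0] at hs
    · rcases hi.lt_or_eq with hi | rfl
      · exact hsep' _ _ (hwlt i hi0 hi) (hcount0 i)
      · intro s _ t ht
        rw [← hlen, List.take_length, hw0, hRn] at ht
        exact absurd (Finset.mem_univ t) ht
  have key : ∀ i ≤ 2 * n, HasWord (range P.root) ∅ (w.take i)
      (b.sweepSet (R ((w.take i).count 0)) (A ((w.take i).count 1))) := by
    intro i
    induction i with
    | zero =>
      intro _
      simp only [List.take_zero, List.count_nil, hR0, hA0, b.sweepSet_empty]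
      exact ⟨[], rfl, rfl⟩
    | succ i ih =>
      intro hi
      have hi' : i < w.length := by omega
      have hs := hstate i (by omega)
      have hs' := hstate (i + 1) hi
      have hc0 := hcount0 (i + 1)
      have hc1 := hcount1 (i + 1)
      have htake : w.take (i + 1) = w.take i ++ [w[i]] := by
        rw [List.take_append_getElem]
      refine htake ▸ hasWord_append.mpr ⟨_, ih (by omega), hasWord_cons.mpr ⟨_, ?_, [], rfl, rfl⟩⟩
      rw [htake] at hs' hc0 hc1
      refine ⟨hs'.isBiclosedIn, ?_⟩
      rw [List.count_append] at hs' hc0 hc1 ⊢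
      rw [List.count_append] at hs' ⊢
      generalize w[i] = ε at *
      fin_cases ε
      · simp at hs' hc0 hc1 ⊢
        exact hs.sweepSet_step_zero (hR _ (by omega))
      · simp at hs' hc0 hc1 ⊢
        exact hs'.sweepSet_step_one (hA _ (by omega))
  have := key (2 * n) le_rfl
  rwa [← hlen, List.take_length, hw0, hw1, hRn, hAn, b.sweepSet_univ] at this

theorem lemma4p2 {ι V V' : Type*} [Finite ι]
    [AddCommGroup V] [Module ℝ V] [AddCommGroup V'] [Module ℝ V']
    (P : RootPairing ι ℝ V V') [P.IsRootSystem] [P.IsCrystallographic] [P.IsReduced]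
    [P.IsIrreducible] (n : ℕ) (hn : n = Module.finrank ℝ V) :
    {w : List (Fin 2) | ∃ (k : ℕ) (B : Fin (k + 1) → Set V),
        IsMaximalAdmissibleChain (Set.range P.root) B ∧ signature B = w}
      = {w | IsExtendedDyckWord n w} ∧
    {w : List (Fin 2) | ∃ (k : ℕ) (B : Fin (k + 1) → Set V),
        IsAdmissibleChain (Set.range P.root) B ∧ signature B = w}
      = {w | IsTrimmedDyckWord n w} := by
  subst hn
  constructor <;> ext w
  · rw [Set.mem_ofPred_eq, Set.mem_ofPred_eq, exists_isMaximalAdmissibleChain_iff]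
    refine ⟨fun h ↦ h.1.isExtendedDyckWord h.2, fun h ↦ ⟨h.hasWord P, ?_⟩⟩
    rw [← count_zero_add_count_one, h.1, h.2.1]
    omega
  · rw [Set.mem_ofPred_eq, Set.mem_ofPred_eq, exists_isAdmissibleChain_iff]
    refine ⟨fun h ↦ h.isTrimmedDyckWord, ?_⟩
    rintro ⟨blocks, hb, hw, rfl⟩
    exact (hw.hasWord P).map_fst hb
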